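/- Let $d \in \mathbb{N}$, $\lambda > 0$ and $\Lambda, Y \in \mathbb{R}$. For $X_1,\dots,X_N \in \mathbb{R}^{d\times d}$ and $y^* \in \mathbb{R}^N$ consider the matrix factorization model $f((U,V),X) = \langle UV^\top, X\rangle$ with $U,V \in \mathbb{R}^{d\times k}$, write $W = \begin{bmatrix}U\\V\end{bmatrix}$, and let $L(W) = \sum_{n=1}^N (f(W,X_n)-y^*_n)^2$. Let $W(t)$ be the gradient flow $\dot W = -\nabla L(W)$, $t\ge 0$, started at $W(0) = \begin{bmatrix}U(0)\\V(0)\end{bmatrix}$. Let $W_{\mathrm{TK}}(t)$ be the gradient flow with $W_{\mathrm{TK}}(0)=W(0)$ on the squared loss $\sum_n (f_{\mathrm{TK}}(W,X_n)-y^*_n)^2$ of the tangent kernel model $f_{\mathrm{TK}}(W,X) = f(W(0),X) + \langle \nabla_W f(W(0),X), W-W(0)\rangle$. Let $\mathcal{X}\in\mathbb{R}^{N\times d^2}$ be the matrix with rows $\mathrm{vec}(X_n)$, and assume throughout that $\lambda I \preceq \mathcal{X}\mathcal{X}^\top \preceq \Lambda I$ and $\|y^*\|_2 \le Y$. (a)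 There is a constant $C>0$ depending only on $d,\lambda,\Lambda,Y$ such that for every $c_0>0$ there is $K$, depending only on $d,\lambda,\Lambda,Y,c_0$, for which the following holds for all $k\ge K$, all $\alpha>0$ with $\alpha^2 \ge c_0/k$, and all $N$, $X_1,\dots,X_N$, $y^*$ as above. If the entries of $U(0),V(0)$ are i.i.d. $\mathcal{N}(0,\alpha^2)$, then with probability at least $1-2e^{-d}$ both flows exist for all $t\ge0$ and $$\sup_{T\ge 0}\|W(T)-W(0)\|_F \le C\Big(\frac{1}{\alpha\sqrt{k}}+\alpha\Big), \qquad \sup_{T\ge 0}\|W(T)-W_{\mathrm{TK}}(T)\|_F \le C\Big(\frac{1}{\alpha^3k^{3/2}}+\frac{1}{\alpha\sqrt{k}}+\alpha\Big).$$ (b) Consequently the model stays in the kernel regime when $\sigma = \alpha^2\sqrt{k}$ is $\omega(1/\sqrt{k})$: let $\alpha = \alpha(k) > 0$ be such that $1/\sqrt{k} = o(\alpha(k)^2\sqrt{k})$ as $k\to\infty$. Then for every $\varepsilon>0$ there is $K$, depending only on $d,\lambda,\Lambda,Y,\varepsilon$ and the sequence $\alpha(\cdot)$, such that for all $k\ge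 K$ and all $N$, $X_1,\dots,X_N$, $y^*$ as above, if $U(0),V(0)$ have i.i.d. $\mathcal{N}(0,\alpha(k)^2)$ entries, then with probability at least $1-2e^{-d}$ both flows exist for all $t\ge 0$ and, for all $T\ge0$, $$\|W(T)-W_{\mathrm{TK}}(T)\|_F\le\varepsilon\|W(0)\|_F$$ and the tangent kernel $K_W(A,B) = \langle\nabla_W f(W,A),\nabla_W f(W,B)\rangle$ satisfies $$|K_{W(T)}(A,B)-K_{W(0)}(A,B)| \le \varepsilon\sqrt{K_{W(0)}(A,A)}\,\sqrt{K_{W(0)}(B,B)} \quad\text{for all } A,B\in\mathbb{R}^{d\times d}.$$ -/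

import Mathlib

open MeasureTheory ProbabilityTheory Filter Asymptotics

noncomputable section

namespace MatrixFactorization

/-- The parameter space of pairs `(U, V)` of real `d × k` matrices, stored as the stacked
`2d × k` matrix `W = [U; V]`. The Euclidean norm is the Frobenius norm of `W`. -/
abbrev Param (d k : ℕ) : Type := EuclideanSpace ℝ ((Fin d ⊕ Fin d) × Fin k)

/-- The upper block `U` of `W = [U; V]`. -/
def upper {d k : ℕ} (W : Param d k) : Matrix (Fin d) (Fin k) ℝ :=
  Matrix.of fun i j => W (Sum.inl i, j)

/-- The lower block `V` of `W = [U; V]`. -/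
def lower {d k : ℕ} (W : Param d k) : Matrix (Fin d) (Fin k) ℝ :=
  Matrix.of fun i j => W (Sum.inr i, j)

/-- The Frobenius inner product of two matrices. -/
def frobInner {d : ℕ} (A B : Matrix (Fin d) (Fin d) ℝ) : ℝ :=
  ∑ i, ∑ j, A i j * B i j

/-- The model `f((U, V), X) = ⟨U Vᵀ, X⟩`. -/
def predict {d k : ℕ} (W : Param d k) (X : Matrix (Fin d) (Fin d) ℝ) : ℝ :=
  frobInner (upper W * (lower W).transpose) X

/-- The model linearized at `W₀` (the tangent kernel model):
`f(W₀, X) + ⟨∇ f(W₀, X), W - W₀⟩`. -/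
def predictTK {d k : ℕ} (W₀ W : Param d k) (X : Matrix (Fin d) (Fin d) ℝ) : ℝ :=
  predict W₀ X + inner ℝ (gradient (fun W' : Param d k => predict W' X) W₀) (W - W₀)

/-- The squared loss of the factorization model. -/
def loss {d k N : ℕ} (X : Fin N → Matrix (Fin d) (Fin d) ℝ) (y : EuclideanSpace ℝ (Fin N))
    (W : Param d k) : ℝ :=
  ∑ n, (predict W (X n) - y n) ^ 2

/-- The squared loss of the model linearized at `W₀`. -/
def lossTK {d k N : ℕ} (X : Fin N → Matrix (Fin d) (Fin d) ℝ) (y : EuclideanSpace ℝ (Fin N))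
    (W₀ W : Param d k) : ℝ :=
  ∑ n, (predictTK W₀ W (X n) - y n) ^ 2

/-- `w` is a gradient flow path `w' = - ∇ L(w)` on `[0, ∞)` with `w(0) = w₀`. -/
def IsGradientFlow {F : Type*} [NormedAddCommGroup F] [InnerProductSpace ℝ F] [CompleteSpace F]
    (L : F → ℝ) (w₀ : F) (w : ℝ → F) : Prop :=
  w 0 = w₀ ∧ ∀ t : ℝ, 0 ≤ t → HasDerivWithinAt w (-gradient L (w t)) (Set.Ici 0) t

/-- The tangent kernel `K_W(X, X') = ⟨∇ f(W, X), ∇ f(W, X')⟩`. -/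
def tangentKernel {d k : ℕ} (W : Param d k) (X X' : Matrix (Fin d) (Fin d) ℝ) : ℝ :=
  inner ℝ (gradient (fun W' : Param d k => predict W' X) W)
    (gradient (fun W' : Param d k => predict W' X') W)

/-- The `N × d²` matrix whose `n`-th row is `vec(X n)`. -/
def measurementMatrix {d N : ℕ} (X : Fin N → Matrix (Fin d) (Fin d) ℝ) :
    Matrix (Fin N) (Fin d × Fin d) ℝ :=
  Matrix.of fun n p => X n p.1 p.2

/-- `lam • I ⪯ 𝒳 𝒳ᵀ ⪯ Lam • I` in the Loewner order, where the rows of `𝒳` are `vec(X n)`. -/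
def WellConditioned {d N : ℕ} (X : Fin N → Matrix (Fin d) (Fin d) ℝ) (lam Lam : ℝ) : Prop :=
  (measurementMatrix X * (measurementMatrix X).transpose - lam • 1).PosSemidef ∧
  (Lam • 1 - measurementMatrix X * (measurementMatrix X).transpose).PosSemidef

/-- All entries of the random initialization `W₀ = [U(0); V(0)]` are independent with law
`N(0, α²)`. -/
def IsGaussianInit {d k : ℕ} {Ω : Type*} [MeasurableSpace Ω] (P : Measure Ω) (α : ℝ)
    (W₀ : Ω → Param d k) : Prop :=
  iIndepFun (fun p ω => W₀ ω p) P ∧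
  ∀ p, HasLaw (fun ω => W₀ ω p) (gaussianReal 0 (α ^ 2).toNNReal) P

end MatrixFactorization

end

/-!
Both flows travel only a short distance from `W₀ = W(0)`, and every bound follows from this.

*Short travel.* If `‖∇L‖ ≥ 2 s √L` along a gradient flow of `L ≥ 0`, then the flow has length at
most `√L(W₀) / s`, because its speed is at most `-(√L)' / s`
(`IsSlowedGradientFlow.norm_sub_le`). The same bound holds for a flow slowed down by a cutoff, and
therefore also gives existence for all times (`exists_isGradientFlow_of_bound`).

*The inequality.* For the loss at hand `∇L(W) = 2 [M V; Mᵀ U]` with `M = ∑ₙ rₙ Xₙ`, where `r` is the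
residual, and `‖M‖² ≥ λ L`. So it suffices to bound the singular values of `U` and `V` from below.
No smallness of `W - W₀` is needed for this: the flow preserves `UᵀU - VᵀV`
(`balanced_of_hasDerivWithinAt`), and if `W₀ W₀ᵀ` is close to `m I` with `m = kα²`, any `W` with the
same balance has singular values at least `√m / 2` (`norm_sq_le_norm_adjoint_sq`). This gives
`s = √(λ m / 2)` for all times, for the model and for its linearization alike.

*Initialization.* The entries of `W₀ W₀ᵀ - m I` have variance of order `kα⁴`, so by Markov's
inequality its norm is of order `√k α²` outside an event of probability `exp (-d)`
(`IsGaussianInit.exists_event`). For large `k` this is less than `m / 4`. It also bounds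
`‖U(0) V(0)ᵀ‖`, and hence `√L(W₀)` by a multiple of `1 + √k α²`. Dividing by `s`, either flow
travels at most `C (1 / (α √k) + α)`; the distance between the two flows follows from the triangle
inequality (`flows_of_gramDev_le`).

*Kernel regime.* Divided by `‖W₀‖ ≥ α √k` (for `d ≥ 1`), the distance travelled is of
order `1 / (kα²) + 1 / √k`, which tends to zero. The gradient of the model is linear in `W`, so its relative change, and with it
that of the tangent kernel, tends to zero too (`abs_tangentKernel_sub_le`).
-/

noncomputable section

namespace MatrixFactorization

section

/-! ### Gradient flows under a Polyak–Łojasiewicz inequality -/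

open Set in
/-- A bounded, globally Lipschitz vector field has a solution on all of `[0, ∞)`: Picard–Lindelöf
gives one on each `[0, n]`, and by uniqueness these agree where they overlap. -/
theorem exists_solution_Ici_of_bounded_lipschitz {F : Type*} [NormedAddCommGroup F]
    [NormedSpace ℝ F] [CompleteSpace F] {v : F → F} {K B : NNReal} (hv : LipschitzWith K v)
    (hB : ∀ x, ‖v x‖ ≤ B) (x₀ : F) :
    ∃ w : ℝ → F, w 0 = x₀ ∧ ∀ t : ℝ, 0 ≤ t → HasDerivWithinAt w (v (w t)) (Ici 0) t := by
  have hloc : ∀ n : ℕ, ∃ w : ℝ → F, w 0 = x₀ ∧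
      ∀ t ∈ Icc (0 : ℝ) n, HasDerivWithinAt w (v (w t)) (Icc 0 n) t := by
    intro n
    have h0 : (0 : ℝ) ∈ Icc (0 : ℝ) n := ⟨le_rfl, n.cast_nonneg⟩
    have hPL : IsPicardLindelof (fun _ : ℝ => v) (⟨0, h0⟩ : Icc (0 : ℝ) n) x₀ (B * n) 0 B K :=
      IsPicardLindelof.of_time_independent (fun x _ => hB x) hv.lipschitzOnWith (by simp)
    exact hPL.exists_eq_forall_mem_Icc_hasDerivWithinAt₀
  choose W hW0 hW using hloc
  have key : ∀ (n m : ℕ) (s : ℝ), 0 ≤ s → s ≤ n → s ≤ m → W n s = W m s := by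
    intro n m s hs hn hm
    have hcont : ∀ j : ℕ, s ≤ j → ContinuousOn (W j) (Icc 0 s) := fun j hj t ht =>
      ((hW j t ⟨ht.1, ht.2.trans hj⟩).continuousWithinAt).mono (Icc_subset_Icc_right hj)
    have hder : ∀ j : ℕ, s ≤ j → ∀ t ∈ Ico 0 s,
        HasDerivWithinAt (W j) (v (W j t)) (Ici t) t := fun j hj t ht =>
      (hW j t ⟨ht.1, ht.2.le.trans hj⟩).mono_of_mem_nhdsWithin
        (Icc_mem_nhdsGE_of_mem ⟨ht.1, ht.2.trans_le hj⟩)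
    exact ODE_solution_unique (v := fun _ => v) (fun _ => hv) (hcont n hn) (hder n hn)
      (hcont m hm) (hder m hm) (by rw [hW0, hW0]) ⟨hs, le_rfl⟩
  refine ⟨fun t => W (⌊t⌋₊ + 1) t, by simp [hW0], fun t ht => ?_⟩
  have hlt : t < ((⌊t⌋₊ + 1 : ℕ) : ℝ) := by exact_mod_cast Nat.lt_floor_add_one t
  have h1 := (hW (⌊t⌋₊ + 1) t ⟨ht, hlt.le⟩)
  have hmem : Icc (0 : ℝ) ((⌊t⌋₊ + 1 : ℕ) : ℝ) ∈ nhdsWithin t (Ici 0) := by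
    rw [← Ici_inter_Iic]
    exact inter_mem_nhdsWithin _ (Iic_mem_nhds hlt)
  have h2 : HasDerivWithinAt (fun s => W (⌊s⌋₊ + 1) s) (v (W (⌊t⌋₊ + 1) t))
      (Icc 0 ((⌊t⌋₊ + 1 : ℕ) : ℝ)) t := by
    refine h1.congr (fun s hs => ?_) rfl
    exact key _ _ s hs.1 (by exact_mod_cast (Nat.lt_floor_add_one s).le) hs.2
  exact h2.mono_of_mem_nhdsWithin hmem

variable {F : Type*} [NormedAddCommGroup F] [InnerProductSpace ℝ F] [CompleteSpace F]

/-- `w` follows the gradient flow of `L` from `w₀`, run at the time-dependent speed `φ ∈ [0, 1]`.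
Speed `1` is the gradient flow itself; speeds that vanish far from `w₀` serve to prove existence. -/
def IsSlowedGradientFlow (L : F → ℝ) (w₀ : F) (φ : ℝ → ℝ) (w : ℝ → F) : Prop :=
  w 0 = w₀ ∧ ∀ t : ℝ, 0 ≤ t → φ t ∈ Set.Icc (0 : ℝ) 1 ∧
    HasDerivWithinAt w (-(φ t • gradient L (w t))) (Set.Ici 0) t

theorem IsGradientFlow.isSlowedGradientFlow {L : F → ℝ} {w₀ : F} {w : ℝ → F}
    (h : IsGradientFlow L w₀ w) : IsSlowedGradientFlow L w₀ (fun _ => 1) w :=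
  ⟨h.1, fun t ht => ⟨⟨zero_le_one, le_rfl⟩, by simpa using h.2 t ht⟩⟩

theorem IsSlowedGradientFlow.continuousOn {L : F → ℝ} {w₀ : F} {φ : ℝ → ℝ} {w : ℝ → F}
    (h : IsSlowedGradientFlow L w₀ φ w) : ContinuousOn w (Set.Ici 0) :=
  fun t ht => (h.2 t ht).2.continuousWithinAt

theorem _root_.HasGradientAt.comp_hasDerivWithinAt {L : F → ℝ} {g : F} {w : ℝ → F} {w' : F} {t : ℝ}
    {s : Set ℝ} (hL : HasGradientAt L g (w t)) (hw : HasDerivWithinAt w w' s t) :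
    HasDerivWithinAt (fun τ => L (w τ)) (inner ℝ g w') s t := by
  have := hL.hasFDerivAt.comp_hasDerivWithinAt t hw
  simpa [Function.comp_def] using this

/-- If `‖∇L‖ ≥ 2 s √L` along the path, then the path has length at most `√L(w₀) / s`: its speed
`φ ‖∇L‖` is at most `φ ‖∇L‖² / (2 s √L) = -(√L)' / s`. Since `√L` need not be differentiable where
`L` vanishes, the estimate is made for `√(L + ε)`, at the cost of an error `2 s √ε` in the speed. -/
theorem IsSlowedGradientFlow.norm_sub_le {L : F → ℝ} {w₀ : F} {φ : ℝ → ℝ} {w : ℝ → F} {s : ℝ}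
    (h : IsSlowedGradientFlow L w₀ φ w) (hs : 0 < s) (hL : Differentiable ℝ L)
    (hL0 : ∀ x, 0 ≤ L x)
    (hPL : ∀ t, 0 ≤ t → 4 * s ^ 2 * L (w t) ≤ ‖gradient L (w t)‖ ^ 2) {T : ℝ} (hT : 0 ≤ T) :
    ‖w T - w₀‖ ≤ √(L w₀) / s := by
  have main : ∀ ε : ℝ, 0 < ε → ‖w T - w₀‖ ≤ √(L w₀ + ε) / s + 2 * s * √ε * T := by
    intro ε hε
    set B : ℝ → ℝ := fun t => (√(L w₀ + ε) - √(L (w t) + ε)) / s + 2 * s * √ε * t with hBdef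
    set B' : ℝ → ℝ := fun t =>
      (-(-(φ t * ‖gradient L (w t)‖ ^ 2) / (2 * √(L (w t) + ε)))) / s + 2 * s * √ε with hB'def
    have hBder : ∀ t, 0 ≤ t → HasDerivWithinAt B (B' t) (Set.Ici 0) t := by
      intro t ht
      have h1 := ((hL (w t)).hasGradientAt).comp_hasDerivWithinAt (h.2 t ht).2
      rw [inner_neg_right, real_inner_smul_right, real_inner_self_eq_norm_sq] at h1
      have h2 := (h1.add_const ε).sqrt (by have := hL0 (w t); positivity)
      have h3 := (h2.const_sub (√(L w₀ + ε))).div_const s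
      have h4 := ((hasDerivWithinAt_id t (Set.Ici 0)).const_mul (2 * s * √ε))
      exact (h3.add h4).congr_deriv (by simp [hB'def])
    have hbound := image_norm_le_of_norm_deriv_right_le_deriv_boundary' (a := 0) (b := T)
      (f := fun t => w t - w₀) (f' := fun t => -(φ t • gradient L (w t))) (B := B) (B' := B')
      ((h.continuousOn.mono Set.Icc_subset_Ici_self).sub continuousOn_const)
      (fun t ht => ((h.2 t ht.1).2.sub_const w₀).mono (Set.Ici_subset_Ici.2 ht.1))
      (by simp [hBdef, h.1])
      (fun t ht => (hBder t ht.1).continuousWithinAt.mono Set.Icc_subset_Ici_self)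
      (fun t ht => (hBder t ht.1).mono (Set.Ici_subset_Ici.2 ht.1))
      (fun t ht => ?_) ⟨hT, le_rfl⟩
    · refine hbound.trans ?_
      simp only [hBdef]
      gcongr
      have := Real.sqrt_nonneg (L (w T) + ε)
      linarith
    · obtain ⟨⟨hφ0, hφ1⟩, -⟩ := h.2 t ht.1
      rw [norm_neg, norm_smul, Real.norm_of_nonneg hφ0]
      set g := ‖gradient L (w t)‖
      have hg : 0 ≤ g := norm_nonneg _
      set r := √(L (w t) + ε)
      have hr : 0 < r := Real.sqrt_pos.2 (by have := hL0 (w t); positivity)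
      have hgl : 2 * s * √(L (w t)) ≤ g := by
        refine le_of_sq_le_sq ?_ hg
        rw [mul_pow, mul_pow, Real.sq_sqrt (hL0 _)]
        linarith [hPL t ht.1]
      have hrl : r ≤ √(L (w t)) + √ε := by
        refine Real.sqrt_le_iff.2 ⟨by positivity, ?_⟩
        nlinarith [Real.sq_sqrt (hL0 (w t)), Real.sq_sqrt hε.le,
          Real.sqrt_nonneg (L (w t)), Real.sqrt_nonneg ε,
          mul_nonneg (Real.sqrt_nonneg (L (w t))) (Real.sqrt_nonneg ε)]
      -- `g - g² / (2 s r) ≤ 2 s r - g` holds for every `g` (complete the square)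
      have key : g ≤ g ^ 2 / (2 * r * s) + 2 * s * √ε := by
        have h1 : g - g ^ 2 / (2 * r * s) ≤ 2 * s * r - g := by
          rw [sub_le_iff_le_add, ← sub_le_iff_le_add', le_div_iff₀ (by positivity)]
          nlinarith [sq_nonneg (g - 2 * s * r)]
        have h2 : 2 * s * r ≤ 2 * s * (√(L (w t)) + √ε) := by gcongr
        linarith
      calc φ t * g ≤ φ t * (g ^ 2 / (2 * r * s) + 2 * s * √ε) := by gcongr
        _ = φ t * g ^ 2 / (2 * r) / s + φ t * (2 * s * √ε) := by field_simp
        _ ≤ φ t * g ^ 2 / (2 * r) / s + 1 * (2 * s * √ε) := by gcongr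
        _ = B' t := by simp only [hB'def]; ring
  have hlim : Tendsto (fun ε : ℝ => √(L w₀ + ε) / s + 2 * s * √ε * T) (nhdsWithin 0 (Set.Ioi 0))
      (nhds (√(L w₀) / s)) := by
    have hc : Continuous fun ε : ℝ => √(L w₀ + ε) / s + 2 * s * √ε * T := by fun_prop
    have := (hc.tendsto 0).mono_left (nhdsWithin_le_nhds (s := Set.Ioi 0))
    simpa using this
  exact ge_of_tendsto hlim (eventually_nhdsWithin_of_forall fun ε hε => main ε hε)

/-- A gradient flow exists for all times as soon as all slowed-down flows from `w₀` stay in a fixed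
ball: the field `∇L`, multiplied by a bump function that equals `1` on that ball, is bounded and
Lipschitz, and its solution never leaves the region where the bump function equals `1`. -/
theorem exists_isGradientFlow_of_bound [FiniteDimensional ℝ F] {L : F → ℝ} (hL : ContDiff ℝ 2 L)
    (w₀ : F) (R : ℝ)
    (hR : ∀ φ w, IsSlowedGradientFlow L w₀ φ w → ∀ t, 0 ≤ t → ‖w t - w₀‖ ≤ R) :
    ∃ w, IsGradientFlow L w₀ w := by
  have hR0 : 0 < |R| + 1 := by positivity
  let f : ContDiffBump w₀ := ⟨|R| + 1, |R| + 2, hR0, by linarith⟩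
  have hgrad : ContDiff ℝ 1 (gradient L) :=
    (InnerProductSpace.toDual ℝ F).symm.contDiff.comp (hL.fderiv_right (by norm_num))
  let v : F → F := fun x => -(f x • gradient L x)
  have hv : ContDiff ℝ 1 v := (f.contDiff.smul hgrad).neg
  have hsupp : HasCompactSupport v := (f.hasCompactSupport.smul_right).neg
  obtain ⟨K, hK⟩ := hv.lipschitzWith_of_hasCompactSupport hsupp one_ne_zero
  obtain ⟨B, hB⟩ := hsupp.exists_bound_of_continuous hv.continuous
  obtain ⟨w, hw0, hw⟩ := exists_solution_Ici_of_bounded_lipschitz hK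
    (B := B.toNNReal) (fun x => (hB x).trans (Real.le_coe_toNNReal B)) w₀
  have hslow : IsSlowedGradientFlow L w₀ (fun t => f (w t)) w :=
    ⟨hw0, fun t ht => ⟨⟨f.nonneg, f.le_one⟩, hw t ht⟩⟩
  refine ⟨w, hw0, fun t ht => ?_⟩
  have h1 : f (w t) = 1 := f.one_of_mem_closedBall (by
    rw [mem_closedBall_iff_norm]
    have := hR _ w hslow t ht
    have := le_abs_self R
    change _ ≤ |R| + 1
    linarith)
  simpa [v, h1] using hw t ht

end

section

/-! ### The gradient of the model -/

/-- The linear map `W = [U; V] ↦ [X V; Xᵀ U]`, which sends `W` to the gradient at `W` of the model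
evaluated at `X`. -/
def modelGrad {d : ℕ} (k : ℕ) (X : Matrix (Fin d) (Fin d) ℝ) : Param d k →L[ℝ] Param d k :=
  LinearMap.toContinuousLinearMap
    { toFun := fun W => WithLp.toLp 2 fun p => Sum.elim (fun i => (X * lower W) i p.2)
        (fun i => (X.transpose * upper W) i p.2) p.1
      map_add' := fun W W' => by
        ext ⟨i | i, j⟩ <;>
          simp [Matrix.mul_apply, upper, lower, mul_add, Finset.sum_add_distrib]
      map_smul' := fun c W => by
        ext ⟨i | i, j⟩ <;>
          simp [Matrix.mul_apply, upper, lower, Finset.mul_sum, mul_left_comm] }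

variable {d k N : ℕ}

@[simp] theorem modelGrad_inl (X : Matrix (Fin d) (Fin d) ℝ) (W : Param d k) (i : Fin d)
    (j : Fin k) : modelGrad k X W (Sum.inl i, j) = (X * lower W) i j := rfl

@[simp] theorem modelGrad_inr (X : Matrix (Fin d) (Fin d) ℝ) (W : Param d k) (i : Fin d)
    (j : Fin k) : modelGrad k X W (Sum.inr i, j) = (X.transpose * upper W) i j := rfl

theorem sum_smul_modelGrad (r : Fin N → ℝ) (X : Fin N → Matrix (Fin d) (Fin d) ℝ)
    (W : Param d k) : ∑ n, r n • modelGrad k (X n) W = modelGrad k (∑ n, r n • X n) W := by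
  ext ⟨i | i, j⟩ <;>
  · simp only [WithLp.ofLp_sum, WithLp.ofLp_smul, Finset.sum_apply, Pi.smul_apply, modelGrad_inl,
      modelGrad_inr, Matrix.transpose_sum, Matrix.transpose_smul, Matrix.sum_mul, Matrix.sum_apply,
      Matrix.smul_mul, Matrix.smul_apply]

theorem inner_param (W W' : Param d k) :
    inner ℝ W W' = (∑ i, ∑ j, upper W i j * upper W' i j)
      + ∑ i, ∑ j, lower W i j * lower W' i j := by
  simp only [PiLp.inner_apply, Fintype.sum_prod_type, Fintype.sum_sum_type, upper, lower,
    Matrix.of_apply, RCLike.inner_apply, conj_trivial]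
  simp only [mul_comm]

theorem upper_modelGrad (X : Matrix (Fin d) (Fin d) ℝ) (W : Param d k) :
    upper (modelGrad k X W) = X * lower W := rfl

theorem lower_modelGrad (X : Matrix (Fin d) (Fin d) ℝ) (W : Param d k) :
    lower (modelGrad k X W) = X.transpose * upper W := rfl

theorem inner_modelGrad (X : Matrix (Fin d) (Fin d) ℝ) (W W' : Param d k) :
    inner ℝ (modelGrad k X W) W' =
      frobInner (upper W' * (lower W).transpose) X
        + frobInner (upper W * (lower W').transpose) X := by
  rw [inner_param, upper_modelGrad, lower_modelGrad]
  simp only [frobInner, Matrix.mul_apply, Matrix.transpose_apply, Finset.sum_mul]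
  congr 1
  · refine Finset.sum_congr rfl fun i _ => ?_
    rw [Finset.sum_comm]
    exact Finset.sum_congr rfl fun j _ => Finset.sum_congr rfl fun l _ => by ring
  · calc _ = ∑ i, ∑ l, ∑ j, X l i * upper W l j * lower W' i j :=
          Finset.sum_congr rfl fun i _ => Finset.sum_comm
      _ = _ := by
        rw [Finset.sum_comm]
        exact Finset.sum_congr rfl fun i _ => Finset.sum_congr rfl fun j _ =>
          Finset.sum_congr rfl fun l _ => by ring

theorem predict_eq_inner (X : Matrix (Fin d) (Fin d) ℝ) (W : Param d k) :
    predict W X = 1 / 2 * inner ℝ (modelGrad k X W) W := by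
  rw [inner_modelGrad, predict]; ring

theorem contDiff_predict (X : Matrix (Fin d) (Fin d) ℝ) :
    ContDiff ℝ 2 (fun W : Param d k => predict W X) := by
  simp only [predict_eq_inner]
  exact ((modelGrad k X).contDiff.inner ℝ contDiff_id) |> contDiff_const.mul

theorem hasGradientAt_predict (X : Matrix (Fin d) (Fin d) ℝ) (W : Param d k) :
    HasGradientAt (fun W : Param d k => predict W X) (modelGrad k X W) W := by
  rw [hasGradientAt_iff_hasFDerivAt]
  simp only [predict_eq_inner]
  have h := (((modelGrad k X).hasFDerivAt (x := W)).inner ℝ (hasFDerivAt_id W)).const_mul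
    (1 / 2 : ℝ)
  refine h.congr_fderiv ?_
  ext H
  have h1 : inner ℝ (modelGrad k X H) W = inner ℝ (modelGrad k X W) H := by
    rw [inner_modelGrad, inner_modelGrad, add_comm]
  simp [h1]
  ring

theorem gradient_predict (X : Matrix (Fin d) (Fin d) ℝ) (W : Param d k) :
    gradient (fun W : Param d k => predict W X) W = modelGrad k X W :=
  (hasGradientAt_predict X W).gradient

/-- The matrix `∑ₙ (pₙ - yₙ) Xₙ` for predictions `p`. The gradient of either squared loss is twice
its image under the gradient map of the model. -/
def residualMatrix (X : Fin N → Matrix (Fin d) (Fin d) ℝ) (y : EuclideanSpace ℝ (Fin N))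
    (p : Fin N → ℝ) : Matrix (Fin d) (Fin d) ℝ :=
  ∑ n, (p n - y n) • X n

theorem hasGradientAt_sum_sq {F : Type*} [NormedAddCommGroup F] [InnerProductSpace ℝ F]
    [CompleteSpace F] {p : Fin N → F → ℝ} {g : Fin N → F} {x : F}
    (hp : ∀ n, HasGradientAt (p n) (g n) x) (y : Fin N → ℝ) :
    HasGradientAt (fun x => ∑ n, (p n x - y n) ^ 2) ((2 : ℝ) • ∑ n, (p n x - y n) • g n) x := by
  rw [hasGradientAt_iff_hasFDerivAt]
  have h := HasFDerivAt.fun_sum (u := Finset.univ)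
    fun n _ => (((hp n).hasFDerivAt.sub_const (y n)).pow 2)
  refine h.congr_fderiv ?_
  ext H
  simp [Finset.mul_sum, mul_assoc]

theorem gradient_loss (X : Fin N → Matrix (Fin d) (Fin d) ℝ) (y : EuclideanSpace ℝ (Fin N))
    (W : Param d k) : gradient (loss X y) W =
      (2 : ℝ) • modelGrad k (residualMatrix X y fun n => predict W (X n)) W := by
  rw [residualMatrix, ← sum_smul_modelGrad]
  exact (hasGradientAt_sum_sq (fun n => hasGradientAt_predict (X n) W) y).gradient

theorem contDiff_loss (X : Fin N → Matrix (Fin d) (Fin d) ℝ) (y : EuclideanSpace ℝ (Fin N)) :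
    ContDiff ℝ 2 (loss (k := k) X y) :=
  ContDiff.sum fun n _ => ((contDiff_predict (X n)).sub contDiff_const).pow 2

theorem hasGradientAt_predictTK (X : Matrix (Fin d) (Fin d) ℝ) (W₀ W : Param d k) :
    HasGradientAt (fun W : Param d k => predictTK W₀ W X) (modelGrad k X W₀) W := by
  rw [hasGradientAt_iff_hasFDerivAt]
  simp only [predictTK, gradient_predict]
  have h := (((innerSL ℝ (modelGrad k X W₀)).hasFDerivAt (x := W - W₀)).comp W
    ((hasFDerivAt_id W).sub_const W₀)).const_add (predict W₀ X)
  refine h.congr_fderiv ?_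
  ext H
  simp

theorem gradient_lossTK (X : Fin N → Matrix (Fin d) (Fin d) ℝ) (y : EuclideanSpace ℝ (Fin N))
    (W₀ W : Param d k) : gradient (lossTK X y W₀) W =
      (2 : ℝ) • modelGrad k (residualMatrix X y fun n => predictTK W₀ W (X n)) W₀ := by
  rw [residualMatrix, ← sum_smul_modelGrad]
  exact (hasGradientAt_sum_sq (fun n => hasGradientAt_predictTK (X n) W₀ W) y).gradient

theorem contDiff_lossTK (X : Fin N → Matrix (Fin d) (Fin d) ℝ) (y : EuclideanSpace ℝ (Fin N))
    (W₀ : Param d k) : ContDiff ℝ 2 (lossTK X y W₀) := by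
  refine ContDiff.sum fun n _ => ((ContDiff.sub ?_ contDiff_const).pow 2)
  unfold predictTK
  exact contDiff_const.add (contDiff_const.inner ℝ (contDiff_id.sub contDiff_const))

theorem lossTK_self (X : Fin N → Matrix (Fin d) (Fin d) ℝ) (y : EuclideanSpace ℝ (Fin N))
    (W₀ : Param d k) : lossTK X y W₀ W₀ = loss X y W₀ := by
  simp [lossTK, loss, predictTK]

/-! ### Conditioning of the measurements -/

theorem WellConditioned.le_frobInner {X : Fin N → Matrix (Fin d) (Fin d) ℝ} {lam Lam : ℝ}
    (h : WellConditioned X lam Lam) (r : Fin N → ℝ) :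
    lam * ∑ n, r n ^ 2 ≤ frobInner (∑ n, r n • X n) (∑ n, r n • X n) ∧
      frobInner (∑ n, r n • X n) (∑ n, r n • X n) ≤ Lam * ∑ n, r n ^ 2 := by
  have hdot : r ⬝ᵥ r = ∑ n, r n ^ 2 := by simp [dotProduct, sq]
  have hfrob : r ⬝ᵥ (measurementMatrix X * (measurementMatrix X).transpose).mulVec r =
      frobInner (∑ n, r n • X n) (∑ n, r n • X n) := by
    rw [← Matrix.mulVec_mulVec, Matrix.dotProduct_mulVec, ← Matrix.mulVec_transpose,
      frobInner, dotProduct, Fintype.sum_prod_type]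
    simp [Matrix.mulVec, dotProduct, measurementMatrix, Matrix.sum_apply, mul_comm]
  have h1 := h.1.dotProduct_mulVec_nonneg r
  have h2 := h.2.dotProduct_mulVec_nonneg r
  simp only [star_trivial, Matrix.sub_mulVec, dotProduct_sub, hfrob, Matrix.smul_mulVec,
    Matrix.one_mulVec, dotProduct_smul, hdot, smul_eq_mul] at h1 h2
  exact ⟨by linarith, by linarith⟩

theorem frobInner_sq_le (A B : Matrix (Fin d) (Fin d) ℝ) :
    frobInner A B ^ 2 ≤ frobInner A A * frobInner B B := by
  simp only [frobInner, ← Fintype.sum_prod_type', ← sq]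
  exact Finset.sum_mul_sq_le_sq_mul_sq _ _ _

theorem frobInner_self_nonneg (A : Matrix (Fin d) (Fin d) ℝ) : 0 ≤ frobInner A A :=
  Finset.sum_nonneg fun _ _ => Finset.sum_nonneg fun _ _ => mul_self_nonneg _

/-- `‖𝒳 z‖² ≤ Λ‖z‖²`, by duality from `‖𝒳ᵀ r‖² ≤ Λ‖r‖²`. The positive part of `Λ` appears because
`Λ` may be negative when there are no measurements. -/
theorem WellConditioned.sum_frobInner_sq_le {X : Fin N → Matrix (Fin d) (Fin d) ℝ} {lam Lam : ℝ}
    (h : WellConditioned X lam Lam) (Z : Matrix (Fin d) (Fin d) ℝ) :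
    ∑ n, frobInner Z (X n) ^ 2 ≤ max Lam 0 * frobInner Z Z := by
  set r : Fin N → ℝ := fun n => frobInner Z (X n) with hr
  have hS : 0 ≤ ∑ n, r n ^ 2 := Finset.sum_nonneg fun _ _ => sq_nonneg _
  have hZ := frobInner_self_nonneg Z
  have h1 : ∑ n, r n ^ 2 = frobInner Z (∑ n, r n • X n) := by
    simp only [sq]
    nth_rw 1 [hr]
    simp only [frobInner, Matrix.sum_apply, Matrix.smul_apply, smul_eq_mul, Finset.mul_sum,
      Finset.sum_mul]
    rw [Finset.sum_comm]
    refine Finset.sum_congr rfl fun i _ => ?_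
    rw [Finset.sum_comm]
    exact Finset.sum_congr rfl fun j _ => Finset.sum_congr rfl fun n _ => by ring
  have h2 := frobInner_sq_le Z (∑ n, r n • X n)
  have h3 : frobInner (∑ n, r n • X n) (∑ n, r n • X n) ≤ max Lam 0 * ∑ n, r n ^ 2 :=
    (h.le_frobInner r).2.trans (by gcongr; exact le_max_left _ _)
  rw [← h1] at h2
  rcases hS.eq_or_lt with h0 | h0
  · rw [← h0]; positivity
  · refine le_of_mul_le_mul_right ?_ h0
    calc (∑ n, r n ^ 2) * ∑ n, r n ^ 2 ≤ frobInner Z Z * (max Lam 0 * ∑ n, r n ^ 2) := by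
          rw [← sq]; exact h2.trans (by gcongr)
      _ = _ := by ring

/-- The loss at `W = [U; V]` is at most `(√Λ ‖U Vᵀ‖ + ‖y‖)²`. -/
theorem sqrt_loss_le {X : Fin N → Matrix (Fin d) (Fin d) ℝ} {lam Lam : ℝ}
    (h : WellConditioned X lam Lam) (y : EuclideanSpace ℝ (Fin N)) (W : Param d k) {b : ℝ}
    (hb : frobInner (upper W * (lower W).transpose) (upper W * (lower W).transpose) ≤ b ^ 2)
    (hb0 : 0 ≤ b) :
    √(loss X y W) ≤ √(max Lam 0) * b + ‖y‖ := by
  set p : EuclideanSpace ℝ (Fin N) := WithLp.toLp 2 fun n => predict W (X n) with hp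
  have h1 : √(loss X y W) = ‖p - y‖ := by
    rw [EuclideanSpace.norm_eq, loss]
    simp [hp]
  have h2 : ‖p‖ ≤ √(max Lam 0) * b := by
    rw [EuclideanSpace.norm_eq]
    refine Real.sqrt_le_iff.2 ⟨by positivity, ?_⟩
    rw [mul_pow, Real.sq_sqrt (le_max_right _ _)]
    simp only [hp, Real.norm_eq_abs, sq_abs]
    exact (h.sum_frobInner_sq_le _).trans (by gcongr)
  rw [h1]
  exact (norm_sub_le _ _).trans (by gcongr)

end

section

/-! ### Balancedness and singular values along the flow -/

/-- If `UᵀU - VᵀV = U₀ᵀU₀ - V₀ᵀV₀`, where `U₀ U₀ᵀ ≈ m` and `V₀ U₀ᵀ ≈ 0`, then the smallest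
singular value of `U` is at least `√m / 2`, whatever the size of `U - U₀`. On the range of `U₀ᵀ`
the conserved form is close to `m`, so that `U U₀ᵀ` is bounded below and hence onto. -/
theorem norm_sq_le_norm_adjoint_sq {E H : Type*} [NormedAddCommGroup E] [InnerProductSpace ℝ E]
    [FiniteDimensional ℝ E] [NormedAddCommGroup H] [InnerProductSpace ℝ H] [FiniteDimensional ℝ H]
    {U V U₀ V₀ : H →ₗ[ℝ] E} {m : ℝ} (hm : 0 < m)
    (hcons : ∀ z, ‖U z‖ ^ 2 - ‖V z‖ ^ 2 = ‖U₀ z‖ ^ 2 - ‖V₀ z‖ ^ 2)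
    (h1 : ∀ a, ‖U₀ (U₀.adjoint a) - m • a‖ ≤ m / 4 * ‖a‖)
    (h2 : ∀ a, ‖V₀ (U₀.adjoint a)‖ ≤ m / 4 * ‖a‖) (x : E) :
    m / 4 * ‖x‖ ^ 2 ≤ ‖U.adjoint x‖ ^ 2 := by
  have hP : ∀ a, m ^ 2 / 2 * ‖a‖ ^ 2 ≤ ‖U (U₀.adjoint a)‖ ^ 2 := by
    intro a
    have h3 : 3 / 4 * m * ‖a‖ ≤ ‖U₀ (U₀.adjoint a)‖ := by
      have := norm_sub_norm_le (m • a) (U₀ (U₀.adjoint a))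
      rw [norm_sub_rev, norm_smul, Real.norm_of_nonneg hm.le] at this
      linarith [h1 a]
    have h4 : (3 / 4 * m * ‖a‖) ^ 2 ≤ ‖U₀ (U₀.adjoint a)‖ ^ 2 := by gcongr
    have h5 : ‖V₀ (U₀.adjoint a)‖ ^ 2 ≤ (m / 4 * ‖a‖) ^ 2 := by gcongr; exact h2 a
    have := hcons (U₀.adjoint a)
    nlinarith [sq_nonneg ‖V (U₀.adjoint a)‖]
  have hinj : Function.Injective (U ∘ₗ U₀.adjoint) := by
    rw [injective_iff_map_eq_zero]
    intro a ha
    have := hP a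
    rw [← LinearMap.comp_apply, ha, norm_zero] at this
    have h0 : ‖a‖ ^ 2 ≤ 0 := by
      by_contra! hlt
      have : 0 < m ^ 2 / 2 * ‖a‖ ^ 2 := by positivity
      linarith
    simpa using le_antisymm h0 (sq_nonneg _)
  obtain ⟨a, rfl⟩ := LinearMap.injective_iff_surjective.1 hinj x
  set x := (U ∘ₗ U₀.adjoint) a with hx
  have h3 : ‖x‖ ^ 2 ≤ ‖U.adjoint x‖ * ‖U₀.adjoint a‖ := by
    rw [← real_inner_self_eq_norm_sq]
    nth_rw 2 [hx]
    rw [LinearMap.comp_apply, ← LinearMap.adjoint_inner_left]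
    exact real_inner_le_norm _ _
  have h4 : ‖U₀.adjoint a‖ ^ 2 ≤ 5 / 4 * m * ‖a‖ ^ 2 := by
    rw [← real_inner_self_eq_norm_sq, LinearMap.adjoint_inner_left]
    have h5 : ‖U₀ (U₀.adjoint a)‖ ≤ 5 / 4 * m * ‖a‖ := by
      have := norm_le_norm_sub_add (U₀ (U₀.adjoint a)) (m • a)
      rw [norm_smul, Real.norm_of_nonneg hm.le] at this
      linarith [h1 a]
    calc _ ≤ ‖a‖ * ‖U₀ (U₀.adjoint a)‖ := real_inner_le_norm _ _
      _ ≤ ‖a‖ * (5 / 4 * m * ‖a‖) := by gcongr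
      _ = _ := by ring
  have h6 : m ^ 2 / 2 * ‖a‖ ^ 2 ≤ ‖x‖ ^ 2 := hP a
  have h7 : (‖x‖ ^ 2) ^ 2 ≤ ‖U.adjoint x‖ ^ 2 * (5 / 4 * m * ‖a‖ ^ 2) := by
    calc (‖x‖ ^ 2) ^ 2 ≤ (‖U.adjoint x‖ * ‖U₀.adjoint a‖) ^ 2 := by gcongr
      _ = ‖U.adjoint x‖ ^ 2 * ‖U₀.adjoint a‖ ^ 2 := by ring
      _ ≤ _ := by gcongr
  have h8 : m * (‖x‖ ^ 2) ^ 2 ≤ 5 / 2 * ‖U.adjoint x‖ ^ 2 * ‖x‖ ^ 2 := by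
    calc m * (‖x‖ ^ 2) ^ 2 ≤ m * (‖U.adjoint x‖ ^ 2 * (5 / 4 * m * ‖a‖ ^ 2)) := by gcongr
      _ = 5 / 2 * ‖U.adjoint x‖ ^ 2 * (m ^ 2 / 2 * ‖a‖ ^ 2) := by ring
      _ ≤ _ := by gcongr
  rcases (sq_nonneg ‖x‖).eq_or_lt with h0 | h0
  · rw [← h0, mul_zero]; positivity
  · refine le_of_mul_le_mul_right ?_ h0
    nlinarith [mul_nonneg (sq_nonneg ‖U.adjoint x‖) h0.le]

variable {d k N : ℕ}

/-- The block `U` of `W`, as a linear map between Euclidean spaces. -/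
def upperLin (W : Param d k) : EuclideanSpace ℝ (Fin k) →ₗ[ℝ] EuclideanSpace ℝ (Fin d) :=
  Matrix.toEuclideanLin (upper W)

/-- The block `V` of `W`, as a linear map between Euclidean spaces. -/
def lowerLin (W : Param d k) : EuclideanSpace ℝ (Fin k) →ₗ[ℝ] EuclideanSpace ℝ (Fin d) :=
  Matrix.toEuclideanLin (lower W)

theorem upperLin_adjoint (W : Param d k) :
    (upperLin W).adjoint = Matrix.toEuclideanLin (upper W).transpose := by
  rw [upperLin, ← Matrix.toEuclideanLin_conjTranspose_eq_adjoint,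
    Matrix.conjTranspose_eq_transpose_of_trivial]

theorem lowerLin_adjoint (W : Param d k) :
    (lowerLin W).adjoint = Matrix.toEuclideanLin (lower W).transpose := by
  rw [lowerLin, ← Matrix.toEuclideanLin_conjTranspose_eq_adjoint,
    Matrix.conjTranspose_eq_transpose_of_trivial]

/-- Evaluation of the block `U` at a fixed vector, as a linear map in `W`. -/
def upperEval (k : ℕ) (z : EuclideanSpace ℝ (Fin k)) :
    Param d k →L[ℝ] EuclideanSpace ℝ (Fin d) :=
  LinearMap.toContinuousLinearMap
    { toFun := fun W => upperLin W z
      map_add' := fun W W' => by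
        ext i
        simp [upperLin, upper, Matrix.mulVec, dotProduct, add_mul, Finset.sum_add_distrib]
      map_smul' := fun c W => by
        ext i
        simp [upperLin, upper, Matrix.mulVec, dotProduct, Finset.mul_sum, mul_assoc] }

/-- Evaluation of the block `V` at a fixed vector, as a linear map in `W`. -/
def lowerEval (k : ℕ) (z : EuclideanSpace ℝ (Fin k)) :
    Param d k →L[ℝ] EuclideanSpace ℝ (Fin d) :=
  LinearMap.toContinuousLinearMap
    { toFun := fun W => lowerLin W z
      map_add' := fun W W' => by
        ext i
        simp [lowerLin, lower, Matrix.mulVec, dotProduct, add_mul, Finset.sum_add_distrib]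
      map_smul' := fun c W => by
        ext i
        simp [lowerLin, lower, Matrix.mulVec, dotProduct, Finset.mul_sum, mul_assoc] }

theorem upperLin_modelGrad (M : Matrix (Fin d) (Fin d) ℝ) (W : Param d k)
    (z : EuclideanSpace ℝ (Fin k)) :
    upperLin (modelGrad k M W) z = Matrix.toEuclideanLin M (lowerLin W z) := by
  ext i
  simp [upperLin, lowerLin, upper_modelGrad, Matrix.mulVec_mulVec]

theorem lowerLin_modelGrad (M : Matrix (Fin d) (Fin d) ℝ) (W : Param d k)
    (z : EuclideanSpace ℝ (Fin k)) :
    lowerLin (modelGrad k M W) z = (Matrix.toEuclideanLin M).adjoint (upperLin W z) := by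
  rw [← Matrix.toEuclideanLin_conjTranspose_eq_adjoint,
    Matrix.conjTranspose_eq_transpose_of_trivial]
  ext i
  simp [upperLin, lowerLin, lower_modelGrad, Matrix.mulVec_mulVec]

/-- Along any path whose velocity is a multiple of `[M V; Mᵀ U]`, for a matrix `M` that may vary
with time, the matrix `UᵀU - VᵀV` is constant. -/
theorem balanced_of_hasDerivWithinAt {w : ℝ → Param d k} {c : ℝ → ℝ}
    {M : ℝ → Matrix (Fin d) (Fin d) ℝ}
    (hw : ∀ t, 0 ≤ t → HasDerivWithinAt w (c t • modelGrad k (M t) (w t)) (Set.Ici 0) t)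
    (z : EuclideanSpace ℝ (Fin k)) {T : ℝ} (hT : 0 ≤ T) :
    ‖upperLin (w T) z‖ ^ 2 - ‖lowerLin (w T) z‖ ^ 2 =
      ‖upperLin (w 0) z‖ ^ 2 - ‖lowerLin (w 0) z‖ ^ 2 := by
  have hder : ∀ t, 0 ≤ t → HasDerivWithinAt
      (fun t => ‖upperLin (w t) z‖ ^ 2 - ‖lowerLin (w t) z‖ ^ 2) 0 (Set.Ici 0) t := by
    intro t ht
    have hu := ((upperEval k z).hasFDerivAt (x := w t)).comp_hasDerivWithinAt t (hw t ht)
    have hl := ((lowerEval k z).hasFDerivAt (x := w t)).comp_hasDerivWithinAt t (hw t ht)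
    refine (hu.norm_sq.sub hl.norm_sq).congr_deriv ?_
    rw [map_smul, map_smul]
    change 2 * inner ℝ (upperLin (w t) z) (c t • upperLin (modelGrad k (M t) (w t)) z)
      - 2 * inner ℝ (lowerLin (w t) z) (c t • lowerLin (modelGrad k (M t) (w t)) z) = 0
    rw [upperLin_modelGrad, lowerLin_modelGrad, real_inner_smul_right, real_inner_smul_right,
      LinearMap.adjoint_inner_right, real_inner_comm (upperLin (w t) z)]
    ring
  exact constant_of_has_deriv_right_zero
    (fun t ht => (hder t ht.1).continuousWithinAt.mono Set.Icc_subset_Ici_self)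
    (fun t ht => (hder t ht.1).mono (Set.Ici_subset_Ici.2 ht.1)) T ⟨hT, le_rfl⟩

theorem norm_sq_modelGrad (M : Matrix (Fin d) (Fin d) ℝ) (W : Param d k) :
    ‖modelGrad k M W‖ ^ 2 = (∑ i, ‖(lowerLin W).adjoint (WithLp.toLp 2 (M i))‖ ^ 2)
      + ∑ i, ‖(upperLin W).adjoint (WithLp.toLp 2 (M.transpose i))‖ ^ 2 := by
  rw [← real_inner_self_eq_norm_sq, inner_param, upper_modelGrad, lower_modelGrad,
    upperLin_adjoint, lowerLin_adjoint]
  simp only [EuclideanSpace.norm_sq_eq, Matrix.mul_apply, Matrix.toLpLin_apply, Matrix.mulVec,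
    dotProduct, Matrix.transpose_apply, Real.norm_eq_abs, sq_abs, ← sq, mul_comm]

theorem frobInner_self_eq_sum_norm_sq (M : Matrix (Fin d) (Fin d) ℝ) :
    frobInner M M = ∑ i, ‖(WithLp.toLp 2 (M i) : EuclideanSpace ℝ (Fin d))‖ ^ 2 := by
  simp only [frobInner, EuclideanSpace.norm_sq_eq, Real.norm_eq_abs, sq_abs, ← sq]

theorem frobInner_transpose_self (M : Matrix (Fin d) (Fin d) ℝ) :
    frobInner M.transpose M.transpose = frobInner M M := by
  simp only [frobInner, Matrix.transpose_apply]
  exact Finset.sum_comm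

/-- A matrix is bounded in operator norm by its Frobenius norm. -/
theorem norm_sq_toEuclideanLin_le {m n : ℕ} (A : Matrix (Fin m) (Fin n) ℝ)
    (x : EuclideanSpace ℝ (Fin n)) :
    ‖Matrix.toEuclideanLin A x‖ ^ 2 ≤ (∑ i, ∑ j, A i j ^ 2) * ‖x‖ ^ 2 := by
  simp only [EuclideanSpace.norm_sq_eq, Matrix.toLpLin_apply, Matrix.mulVec, dotProduct,
    Real.norm_eq_abs, sq_abs]
  rw [Finset.sum_mul]
  exact Finset.sum_le_sum fun i _ => Finset.sum_mul_sq_le_sq_mul_sq _ _ _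

theorem norm_sq_modelGrad_le (M : Matrix (Fin d) (Fin d) ℝ) (W : Param d k) :
    ‖modelGrad k M W‖ ^ 2 ≤ frobInner M M * ‖W‖ ^ 2 := by
  have hW : ‖W‖ ^ 2 = (∑ j, ∑ i, (upper W).transpose j i ^ 2)
      + ∑ j, ∑ i, (lower W).transpose j i ^ 2 := by
    rw [← real_inner_self_eq_norm_sq, inner_param]
    simp only [← sq, Matrix.transpose_apply]
    congr 1 <;> exact Finset.sum_comm
  rw [norm_sq_modelGrad, upperLin_adjoint, lowerLin_adjoint, hW]
  calc _ ≤ (∑ i, (∑ j, ∑ i, (lower W).transpose j i ^ 2)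
        * ‖(WithLp.toLp 2 (M i) : EuclideanSpace ℝ (Fin d))‖ ^ 2)
      + ∑ i, (∑ j, ∑ i, (upper W).transpose j i ^ 2)
        * ‖(WithLp.toLp 2 (M.transpose i) : EuclideanSpace ℝ (Fin d))‖ ^ 2 := by
        gcongr <;> exact norm_sq_toEuclideanLin_le _ _
    _ = _ := by
        rw [← Finset.mul_sum, ← Finset.mul_sum, ← frobInner_self_eq_sum_norm_sq,
          ← frobInner_self_eq_sum_norm_sq, frobInner_transpose_self]
        ring

/-! ### Nearly orthogonal initializations -/

/-- The Gram matrix `W Wᵀ` of the rows of `W = [U; V]`. -/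
def gram (W : Param d k) : Matrix (Fin d ⊕ Fin d) (Fin d ⊕ Fin d) ℝ :=
  Matrix.of fun a b => ∑ j, W (a, j) * W (b, j)

/-- The squared Frobenius distance `‖W Wᵀ - m I‖²`. -/
def gramDev (W : Param d k) (m : ℝ) : ℝ :=
  ∑ a, ∑ b, (gram W a b - if a = b then m else 0) ^ 2

theorem gramDev_eq (W : Param d k) (m : ℝ) :
    gramDev W m = (∑ i, ∑ l, (gram W (Sum.inl i) (Sum.inl l) - if i = l then m else 0) ^ 2)
      + (∑ i, ∑ l, gram W (Sum.inl i) (Sum.inr l) ^ 2)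
      + (∑ i, ∑ l, gram W (Sum.inr i) (Sum.inl l) ^ 2)
      + ∑ i, ∑ l, (gram W (Sum.inr i) (Sum.inr l) - if i = l then m else 0) ^ 2 := by
  simp [gramDev, Fintype.sum_sum_type, Finset.sum_add_distrib]
  ring

theorem frobInner_upper_mul_lower_le (W : Param d k) (m : ℝ) :
    frobInner (upper W * (lower W).transpose) (upper W * (lower W).transpose) ≤ gramDev W m := by
  have h : frobInner (upper W * (lower W).transpose) (upper W * (lower W).transpose) =
      ∑ i, ∑ l, gram W (Sum.inl i) (Sum.inr l) ^ 2 := by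
    simp [frobInner, Matrix.mul_apply, gram, upper, lower, sq]
  rw [h, gramDev_eq]
  have h1 : 0 ≤ ∑ i, ∑ l, (gram W (Sum.inl i) (Sum.inl l) - if i = l then m else 0) ^ 2 := by
    positivity
  have h2 : 0 ≤ ∑ i, ∑ l, gram W (Sum.inr i) (Sum.inl l) ^ 2 := by positivity
  have h3 : 0 ≤ ∑ i, ∑ l, (gram W (Sum.inr i) (Sum.inr l) - if i = l then m else 0) ^ 2 := by
    positivity
  linarith

theorem norm_toEuclideanLin_le_of_sum_sq_le {m n : ℕ} {A : Matrix (Fin m) (Fin n) ℝ} {b : ℝ}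
    (hb : 0 ≤ b) (hA : ∑ i, ∑ j, A i j ^ 2 ≤ b ^ 2) (x : EuclideanSpace ℝ (Fin n)) :
    ‖Matrix.toEuclideanLin A x‖ ≤ b * ‖x‖ := by
  refine le_of_sq_le_sq ?_ (by positivity)
  rw [mul_pow]
  exact (norm_sq_toEuclideanLin_le A x).trans (by gcongr)

/-- The blocks `U Uᵀ - m` and `V Uᵀ`, and the same with `U` and `V` exchanged, are small if `W Wᵀ`
is close to `m`. -/
theorem norm_le_of_gramDev_le {W : Param d k} {m : ℝ} (hm : 0 < m)
    (h : gramDev W m ≤ (m / 4) ^ 2) (a : EuclideanSpace ℝ (Fin d)) :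
    ‖upperLin W ((upperLin W).adjoint a) - m • a‖ ≤ m / 4 * ‖a‖ ∧
      ‖lowerLin W ((upperLin W).adjoint a)‖ ≤ m / 4 * ‖a‖ ∧
      ‖lowerLin W ((lowerLin W).adjoint a) - m • a‖ ≤ m / 4 * ‖a‖ ∧
      ‖upperLin W ((lowerLin W).adjoint a)‖ ≤ m / 4 * ‖a‖ := by
  rw [gramDev_eq] at h
  have hm4 : 0 ≤ m / 4 := by positivity
  have h1 : 0 ≤ ∑ i, ∑ l, (gram W (Sum.inl i) (Sum.inl l) - if i = l then m else 0) ^ 2 := by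
    positivity
  have h2 : 0 ≤ ∑ i, ∑ l, gram W (Sum.inr i) (Sum.inl l) ^ 2 := by positivity
  have h3 : 0 ≤ ∑ i, ∑ l, (gram W (Sum.inr i) (Sum.inr l) - if i = l then m else 0) ^ 2 := by
    positivity
  have h4 : 0 ≤ ∑ i, ∑ l, gram W (Sum.inl i) (Sum.inr l) ^ 2 := by positivity
  have e1 : upperLin W ((upperLin W).adjoint a) - m • a =
      Matrix.toEuclideanLin (upper W * (upper W).transpose - m • 1) a := by
    rw [upperLin_adjoint, upperLin, map_sub, LinearMap.sub_apply]
    ext i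
    simp [Matrix.mulVec_mulVec]
  have e2 : lowerLin W ((upperLin W).adjoint a) =
      Matrix.toEuclideanLin (lower W * (upper W).transpose) a := by
    rw [upperLin_adjoint, lowerLin]
    ext i
    simp [Matrix.mulVec_mulVec]
  have e3 : lowerLin W ((lowerLin W).adjoint a) - m • a =
      Matrix.toEuclideanLin (lower W * (lower W).transpose - m • 1) a := by
    rw [lowerLin_adjoint, lowerLin, map_sub, LinearMap.sub_apply]
    ext i
    simp [Matrix.mulVec_mulVec]
  have e4 : upperLin W ((lowerLin W).adjoint a) =
      Matrix.toEuclideanLin (upper W * (lower W).transpose) a := by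
    rw [lowerLin_adjoint, upperLin]
    ext i
    simp [Matrix.mulVec_mulVec]
  rw [e1, e2, e3, e4]
  refine ⟨norm_toEuclideanLin_le_of_sum_sq_le hm4 ?_ a,
    norm_toEuclideanLin_le_of_sum_sq_le hm4 ?_ a, norm_toEuclideanLin_le_of_sum_sq_le hm4 ?_ a,
    norm_toEuclideanLin_le_of_sum_sq_le hm4 ?_ a⟩
  · refine le_trans (le_of_eq ?_) (by linarith :
      ∑ i, ∑ l, (gram W (Sum.inl i) (Sum.inl l) - if i = l then m else 0) ^ 2 ≤ _)
    simp [Matrix.mul_apply, gram, upper, Matrix.one_apply]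
  · refine le_trans (le_of_eq ?_) (by linarith : ∑ i, ∑ l, gram W (Sum.inr i) (Sum.inl l) ^ 2 ≤ _)
    simp [Matrix.mul_apply, gram, upper, lower]
  · refine le_trans (le_of_eq ?_) (by linarith :
      ∑ i, ∑ l, (gram W (Sum.inr i) (Sum.inr l) - if i = l then m else 0) ^ 2 ≤ _)
    simp [Matrix.mul_apply, gram, lower, Matrix.one_apply]
  · refine le_trans (le_of_eq ?_) (by linarith : ∑ i, ∑ l, gram W (Sum.inl i) (Sum.inr l) ^ 2 ≤ _)
    simp [Matrix.mul_apply, gram, upper, lower]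

/-- The tangent kernel stays uniformly positive definite at every `W` with the same balance
`UᵀU - VᵀV` as an initialization whose rows are nearly orthogonal. -/
theorem mul_frobInner_le_norm_sq_modelGrad {W W₀ : Param d k} {m : ℝ} (hm : 0 < m)
    (h : gramDev W₀ m ≤ (m / 4) ^ 2)
    (hbal : ∀ z, ‖upperLin W z‖ ^ 2 - ‖lowerLin W z‖ ^ 2 =
      ‖upperLin W₀ z‖ ^ 2 - ‖lowerLin W₀ z‖ ^ 2) (M : Matrix (Fin d) (Fin d) ℝ) :
    m / 2 * frobInner M M ≤ ‖modelGrad k M W‖ ^ 2 := by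
  have hU := norm_sq_le_norm_adjoint_sq hm hbal (fun a => (norm_le_of_gramDev_le hm h a).1)
    (fun a => (norm_le_of_gramDev_le hm h a).2.1)
  have hV := norm_sq_le_norm_adjoint_sq (U := lowerLin W) (V := upperLin W) (U₀ := lowerLin W₀)
    (V₀ := upperLin W₀) hm (fun z => by linarith [hbal z])
    (fun a => (norm_le_of_gramDev_le hm h a).2.2.1) (fun a => (norm_le_of_gramDev_le hm h a).2.2.2)
  rw [norm_sq_modelGrad]
  calc m / 2 * frobInner M M = m / 4 * frobInner M M
        + m / 4 * frobInner M.transpose M.transpose := by rw [frobInner_transpose_self]; ring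
    _ ≤ _ := by
        rw [frobInner_self_eq_sum_norm_sq, frobInner_self_eq_sum_norm_sq, Finset.mul_sum,
          Finset.mul_sum]
        gcongr
        · exact hV _
        · exact hU _

end

section

/-! ### Concentration of the Gram matrix of a Gaussian initialization -/

/-- The fourth moment of a standard Gaussian. -/
def gaussianFourthMoment : ℝ := ∫ x, x ^ 4 ∂(gaussianReal 0 1)

theorem gaussianFourthMoment_nonneg : 0 ≤ gaussianFourthMoment :=
  integral_nonneg fun x => by positivity

section

variable {Ω : Type*} [MeasurableSpace Ω] {P : Measure Ω} {α : ℝ} {X Y : Ω → ℝ}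

theorem memLp_four_of_hasLaw_gaussianReal {μ : ℝ} {v : NNReal}
    (hX : HasLaw X (gaussianReal μ v) P) : MemLp X 4 P := by
  have h : MemLp id 4 (P.map X) := by
    rw [hX.map_eq]
    exact memLp_id_gaussianReal' 4 (by norm_num)
  simpa using h.comp_of_map hX.aemeasurable

theorem integral_pow_four_of_hasLaw_gaussianReal
    (hX : HasLaw X (gaussianReal 0 (α ^ 2).toNNReal) P) :
    ∫ ω, X ω ^ 4 ∂P = gaussianFourthMoment * α ^ 4 := by
  have h1 : ∫ ω, X ω ^ 4 ∂P = ∫ x, x ^ 4 ∂(gaussianReal 0 (α ^ 2).toNNReal) :=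
    hX.integral_comp (f := fun x => x ^ 4) (by fun_prop)
  have h2 : gaussianReal 0 (α ^ 2).toNNReal = (gaussianReal 0 1).map (α * ·) := by
    rw [gaussianReal_map_const_mul, mul_zero, mul_one]
    congr 1
    ext
    simp [Real.coe_toNNReal _ (sq_nonneg α)]
  rw [h1, h2, integral_map (by fun_prop) (by fun_prop), gaussianFourthMoment,
    ← integral_mul_const]
  congr 1 with x
  ring

theorem integral_sq_of_hasLaw_gaussianReal
    (hX : HasLaw X (gaussianReal 0 (α ^ 2).toNNReal) P) : ∫ ω, X ω * X ω ∂P = α ^ 2 := by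
  have h1 : ∫ ω, X ω * X ω ∂P = ∫ x, x * x ∂(gaussianReal 0 (α ^ 2).toNNReal) :=
    hX.integral_comp (f := fun x => x * x) (by fun_prop)
  have h2 := variance_eq_sub (memLp_id_gaussianReal' (μ := 0) (v := (α ^ 2).toNNReal) 2 (by simp))
  rw [variance_id_gaussianReal, Real.coe_toNNReal _ (sq_nonneg α)] at h2
  simp only [id_eq, integral_id_gaussianReal, Pi.pow_apply] at h2
  rw [h1]
  simp only [← sq]
  linarith

theorem integral_of_hasLaw_gaussianReal {v : NNReal} (hX : HasLaw X (gaussianReal 0 v) P) :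
    ∫ ω, X ω ∂P = 0 := by
  rw [hX.integral_eq, integral_id_gaussianReal]

theorem memLp_two_mul (hX : MemLp X 4 P) (hY : MemLp Y 4 P) :
    MemLp (fun ω => X ω * Y ω) 2 P := by
  have : ENNReal.HolderTriple 4 4 2 := ⟨by
    rw [← ENNReal.toReal_eq_toReal_iff' (by simp) (by simp)]
    rw [ENNReal.toReal_add (by simp) (by simp)]
    norm_num⟩
  exact hY.mul hX

theorem variance_mul_le [IsProbabilityMeasure P]
    (hX : HasLaw X (gaussianReal 0 (α ^ 2).toNNReal) P)
    (hY : HasLaw Y (gaussianReal 0 (α ^ 2).toNNReal) P) :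
    variance (fun ω => X ω * Y ω) P ≤ gaussianFourthMoment * α ^ 4 := by
  have hX4 := memLp_four_of_hasLaw_gaussianReal hX
  have hY4 := memLp_four_of_hasLaw_gaussianReal hY
  have hXY := memLp_two_mul hX4 hY4
  have iX : Integrable (fun ω => X ω ^ 4) P := by
    have := (memLp_two_mul hX4 hX4).integrable_sq
    refine this.congr (ae_of_all _ fun ω => by ring)
  have iY : Integrable (fun ω => Y ω ^ 4) P := by
    have := (memLp_two_mul hY4 hY4).integrable_sq
    refine this.congr (ae_of_all _ fun ω => by ring)
  calc variance (fun ω => X ω * Y ω) P ≤ ∫ ω, (X ω * Y ω) ^ 2 ∂P :=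
        variance_le_expectation_sq hXY.1
    _ ≤ ∫ ω, (X ω ^ 4 + Y ω ^ 4) / 2 ∂P := by
        refine integral_mono hXY.integrable_sq ((iX.add iY).div_const 2) fun ω => ?_
        nlinarith [sq_nonneg (X ω ^ 2 - Y ω ^ 2)]
    _ = gaussianFourthMoment * α ^ 4 := by
        rw [integral_div, integral_add iX iY, integral_pow_four_of_hasLaw_gaussianReal hX,
          integral_pow_four_of_hasLaw_gaussianReal hY]
        ring

end

variable {d k : ℕ} {Ω : Type*} [MeasurableSpace Ω] {P : Measure Ω} {α : ℝ}
  {W₀ : Ω → Param d k}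

theorem IsGaussianInit.memLp_gram (h : IsGaussianInit P α W₀) (a b : Fin d ⊕ Fin d) :
    MemLp (fun ω => gram (W₀ ω) a b) 2 P := by
  simp only [gram, Matrix.of_apply]
  exact memLp_finsetSum _ fun j _ => memLp_two_mul (memLp_four_of_hasLaw_gaussianReal (h.2 (a, j)))
    (memLp_four_of_hasLaw_gaussianReal (h.2 (b, j)))

theorem IsGaussianInit.integral_gram [IsProbabilityMeasure P]
    (h : IsGaussianInit P α W₀) (a b : Fin d ⊕ Fin d) :
    ∫ ω, gram (W₀ ω) a b ∂P = if a = b then k * α ^ 2 else 0 := by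
  simp only [gram, Matrix.of_apply]
  rw [integral_finsetSum _ fun j _ =>
    (memLp_two_mul (memLp_four_of_hasLaw_gaussianReal (h.2 (a, j)))
      (memLp_four_of_hasLaw_gaussianReal (h.2 (b, j)))).integrable (by norm_num)]
  split_ifs with hab
  · subst hab
    simp [integral_sq_of_hasLaw_gaussianReal (h.2 _)]
  · refine Finset.sum_eq_zero fun j _ => ?_
    have hne : (a, j) ≠ (b, j) := fun heq => hab (congrArg Prod.fst heq)
    have := (h.1.indepFun hne).integral_mul_eq_mul_integral
      (h.2 (a, j)).aemeasurable.aestronglyMeasurable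
      (h.2 (b, j)).aemeasurable.aestronglyMeasurable
    rw [integral_of_hasLaw_gaussianReal (h.2 (a, j)), zero_mul] at this
    exact this

theorem IsGaussianInit.variance_gram_le [IsProbabilityMeasure P]
    (h : IsGaussianInit P α W₀) (a b : Fin d ⊕ Fin d) :
    variance (fun ω => gram (W₀ ω) a b) P ≤ k * (gaussianFourthMoment * α ^ 4) := by
  have hsum : (fun ω => gram (W₀ ω) a b) =
      ∑ j : Fin k, fun ω => W₀ ω (a, j) * W₀ ω (b, j) := by
    ext ω
    simp [gram]
  rw [hsum, IndepFun.variance_sum]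
  · calc _ ≤ ∑ _j : Fin k, gaussianFourthMoment * α ^ 4 :=
          Finset.sum_le_sum fun j _ => variance_mul_le (h.2 _) (h.2 _)
      _ = _ := by simp
  · exact fun j _ => memLp_two_mul (memLp_four_of_hasLaw_gaussianReal (h.2 (a, j)))
      (memLp_four_of_hasLaw_gaussianReal (h.2 (b, j)))
  · intro i _ j _ hij
    have hne : ∀ a b : Fin d ⊕ Fin d, (a, i) ≠ (b, j) := fun a b heq =>
      hij (congrArg Prod.snd heq)
    exact h.1.indepFun_mul_mul₀ (fun p => (h.2 p).aemeasurable) _ _ _ _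
      (hne _ _) (hne _ _) (hne _ _) (hne _ _)

theorem IsGaussianInit.integrable_gram_sub_sq [IsProbabilityMeasure P]
    (h : IsGaussianInit P α W₀) (m : ℝ)
    (a b : Fin d ⊕ Fin d) :
    Integrable (fun ω => (gram (W₀ ω) a b - if a = b then m else 0) ^ 2) P :=
  ((h.memLp_gram a b).sub (memLp_const _)).integrable_sq

theorem IsGaussianInit.integrable_gramDev [IsProbabilityMeasure P]
    (h : IsGaussianInit P α W₀) (m : ℝ) :
    Integrable (fun ω => gramDev (W₀ ω) m) P :=
  integrable_finsetSum _ fun a _ => integrable_finsetSum _ fun b _ =>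
    h.integrable_gram_sub_sq m a b

theorem IsGaussianInit.integral_gramDev_le [IsProbabilityMeasure P] (h : IsGaussianInit P α W₀) :
    ∫ ω, gramDev (W₀ ω) (k * α ^ 2) ∂P ≤
      4 * d ^ 2 * (k * (gaussianFourthMoment * α ^ 4)) := by
  unfold gramDev
  rw [integral_finsetSum _ fun a _ => integrable_finsetSum _ fun b _ =>
    h.integrable_gram_sub_sq _ a b]
  calc _ ≤ ∑ _a : Fin d ⊕ Fin d, ∑ _b : Fin d ⊕ Fin d, k * (gaussianFourthMoment * α ^ 4) := by
        refine Finset.sum_le_sum fun a _ => ?_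
        rw [integral_finsetSum _ fun b _ => h.integrable_gram_sub_sq _ a b]
        refine Finset.sum_le_sum fun b _ => ?_
        rw [← h.integral_gram a b, ← variance_eq_integral (h.memLp_gram a b).1.aemeasurable]
        exact h.variance_gram_le a b
    _ = _ := by
        simp
        ring

/-- The factor by which Markov's inequality lets `‖W₀ W₀ᵀ - kα² I‖` exceed `√k α²`. -/
def devConst (d : ℕ) : ℝ := √(4 * (d ^ 2 * gaussianFourthMoment + 1) * Real.exp d)

theorem devConst_pos (d : ℕ) : 0 < devConst d :=
  Real.sqrt_pos.2 (by have := gaussianFourthMoment_nonneg; positivity)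

/-- With probability at least `1 - 2 exp (-d)`, the rows of `W₀` are orthogonal up to a relative
error of order `1 / √k`. As constants may depend on `d`, a second-moment bound suffices. -/
theorem IsGaussianInit.exists_event [IsProbabilityMeasure P]
    (h : IsGaussianInit P α W₀) (hk : 0 < k) (hα : 0 < α) :
    ∃ E : Set Ω, MeasurableSet E ∧ ENNReal.ofReal (1 - 2 * Real.exp (-(d : ℝ))) ≤ P E ∧
      ∀ ω ∈ E, gramDev (W₀ ω) (k * α ^ 2) ≤ (devConst d * √k * α ^ 2) ^ 2 := by
  set f : Ω → ℝ := fun ω => gramDev (W₀ ω) (k * α ^ 2) with hf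
  set t : ℝ := (devConst d * √k * α ^ 2) ^ 2 with ht
  have hk' : (0 : ℝ) < k := by exact_mod_cast hk
  have ht0 : 0 < t := by have := devConst_pos d; positivity
  have hnull : NullMeasurableSet {ω | t ≤ f ω} P :=
    nullMeasurableSet_le aemeasurable_const (h.integrable_gramDev _).1.aemeasurable
  obtain ⟨E, hEsub, hE, hEae⟩ := hnull.compl.exists_measurable_subset_ae_eq
  have hmarkov : t * P.real {ω | t ≤ f ω} ≤ t * Real.exp (-(d : ℝ)) := by
    refine (mul_meas_ge_le_integral_of_nonneg (ae_of_all _ fun ω => ?_)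
      (h.integrable_gramDev _) t).trans (h.integral_gramDev_le.trans ?_)
    · simp only [gramDev, Pi.zero_apply]
      positivity
    · have h4 := gaussianFourthMoment_nonneg
      have e1 : Real.exp d * Real.exp (-(d : ℝ)) = 1 := by rw [← Real.exp_add]; simp
      have e2 : t * Real.exp (-(d : ℝ)) =
          4 * (d ^ 2 * gaussianFourthMoment + 1) * (k * α ^ 4) := by
        rw [ht, mul_pow, mul_pow, Real.sq_sqrt hk'.le, devConst, Real.sq_sqrt (by positivity)]
        linear_combination (4 * (d ^ 2 * gaussianFourthMoment + 1) * (k * α ^ 4)) * e1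
      rw [e2]
      have : 0 ≤ k * α ^ 4 := by positivity
      nlinarith
  have hreal : P.real {ω | t ≤ f ω} ≤ Real.exp (-(d : ℝ)) := le_of_mul_le_mul_left hmarkov ht0
  refine ⟨E, hE, ?_, fun ω hω => ?_⟩
  · rw [measure_congr hEae]
    refine ENNReal.ofReal_le_of_le_toReal ?_
    change _ ≤ P.real _
    rw [probReal_compl_eq_one_sub₀ hnull]
    have := Real.exp_pos (-(d : ℝ))
    linarith
  · have hlt : ¬ t ≤ f ω := hEsub hω
    exact (not_le.1 hlt).le

end

section

/-! ### Distance travelled by the two flows -/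

variable {d k N : ℕ} {X : Fin N → Matrix (Fin d) (Fin d) ℝ} {y : EuclideanSpace ℝ (Fin N)}
  {lam Lam m : ℝ} {W₀ : Param d k}

theorem WellConditioned.polyakLojasiewicz (h : WellConditioned X lam Lam) (hm : 0 < m)
    {W : Param d k} {p : Fin N → ℝ}
    (hW : ∀ M, m / 2 * frobInner M M ≤ ‖modelGrad k M W‖ ^ 2) :
    4 * (lam * m / 2) * ∑ n, (p n - y n) ^ 2 ≤
      ‖(2 : ℝ) • modelGrad k (residualMatrix X y p) W‖ ^ 2 := by
  have h1 := (h.le_frobInner fun n => p n - y n).1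
  have h2 := hW (residualMatrix X y p)
  rw [norm_smul, mul_pow]
  have h3 : m / 2 * (lam * ∑ n, (p n - y n) ^ 2) ≤
      m / 2 * frobInner (residualMatrix X y p) (residualMatrix X y p) := by
    gcongr
    exact h1
  norm_num
  linarith

theorem IsSlowedGradientFlow.norm_sub_le_loss {φ : ℝ → ℝ} {w : ℝ → Param d k}
    (hw : IsSlowedGradientFlow (loss X y) W₀ φ w) (h : WellConditioned X lam Lam)
    (hlam : 0 < lam) (hm : 0 < m) (hdev : gramDev W₀ m ≤ (m / 4) ^ 2) {T : ℝ} (hT : 0 ≤ T) :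
    ‖w T - W₀‖ ≤ √(loss X y W₀) / √(lam * m / 2) := by
  have hbal : ∀ t, 0 ≤ t → ∀ z, ‖upperLin (w t) z‖ ^ 2 - ‖lowerLin (w t) z‖ ^ 2 =
      ‖upperLin W₀ z‖ ^ 2 - ‖lowerLin W₀ z‖ ^ 2 := by
    intro t ht z
    rw [← hw.1]
    refine balanced_of_hasDerivWithinAt (c := fun t => -(φ t * 2))
      (M := fun t => residualMatrix X y fun n => predict (w t) (X n)) (fun t ht => ?_) z ht
    simpa [gradient_loss, smul_smul] using (hw.2 t ht).2
  refine hw.norm_sub_le (by positivity) ((contDiff_loss X y).differentiable (by norm_num))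
    (fun x => Finset.sum_nonneg fun _ _ => sq_nonneg _) (fun t ht => ?_) hT
  rw [Real.sq_sqrt (by positivity), gradient_loss]
  exact h.polyakLojasiewicz hm (mul_frobInner_le_norm_sq_modelGrad hm hdev (hbal t ht))

theorem IsSlowedGradientFlow.norm_sub_le_lossTK {φ : ℝ → ℝ} {w : ℝ → Param d k}
    (hw : IsSlowedGradientFlow (lossTK X y W₀) W₀ φ w) (h : WellConditioned X lam Lam)
    (hlam : 0 < lam) (hm : 0 < m) (hdev : gramDev W₀ m ≤ (m / 4) ^ 2) {T : ℝ} (hT : 0 ≤ T) :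
    ‖w T - W₀‖ ≤ √(loss X y W₀) / √(lam * m / 2) := by
  rw [← lossTK_self]
  refine hw.norm_sub_le (by positivity) ((contDiff_lossTK X y W₀).differentiable (by norm_num))
    (fun x => Finset.sum_nonneg fun _ _ => sq_nonneg _) (fun t ht => ?_) hT
  rw [Real.sq_sqrt (by positivity), gradient_lossTK]
  exact h.polyakLojasiewicz hm (mul_frobInner_le_norm_sq_modelGrad hm hdev fun z => rfl)

/-- The constant in the bound on the distance travelled by either flow. -/
def travelConst (d : ℕ) (lam Lam Y : ℝ) : ℝ :=
  (√(max Lam 0) * devConst d + |Y| + 1) / √(lam / 2)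

theorem travelConst_pos (d : ℕ) {lam : ℝ} (Lam Y : ℝ) (hlam : 0 < lam) :
    0 < travelConst d lam Lam Y := by
  have := devConst_pos d
  have : 0 < √(lam / 2) := Real.sqrt_pos.2 (by positivity)
  unfold travelConst
  positivity

theorem sqrt_loss_div_le {Y α : ℝ} (h : WellConditioned X lam Lam) (hY : ‖y‖ ≤ Y) (hlam : 0 < lam)
    (hk : 0 < k) (hα : 0 < α)
    (hdev : gramDev W₀ (k * α ^ 2) ≤ (devConst d * √k * α ^ 2) ^ 2) :
    √(loss X y W₀) / √(lam * (k * α ^ 2) / 2) ≤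
      travelConst d lam Lam Y * (1 / (α * √k) + α) := by
  have hk' : (0 : ℝ) < k := by exact_mod_cast hk
  have hsk : 0 < √(k : ℝ) := Real.sqrt_pos.2 hk'
  have hsl : 0 < √(lam / 2) := Real.sqrt_pos.2 (by positivity)
  have hκ := devConst_pos d
  have hs : √(lam * (k * α ^ 2) / 2) = √(lam / 2) * (α * √k) := by
    rw [show lam * (k * α ^ 2) / 2 = lam / 2 * (α ^ 2 * k) by ring,
      Real.sqrt_mul (by positivity), Real.sqrt_mul (by positivity), Real.sqrt_sq hα.le]
  have h1 := sqrt_loss_le h y W₀ ((frobInner_upper_mul_lower_le W₀ _).trans hdev) (by positivity)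
  have hYabs : ‖y‖ ≤ |Y| := hY.trans (le_abs_self Y)
  have hL := Real.sqrt_nonneg (max Lam 0)
  rw [hs, div_le_iff₀ (by positivity)]
  have h2 : travelConst d lam Lam Y * (1 / (α * √k) + α) * (√(lam / 2) * (α * √k)) =
      (√(max Lam 0) * devConst d + |Y| + 1) * (1 + α ^ 2 * √k) := by
    unfold travelConst
    field_simp
  rw [h2]
  have : 0 < α ^ 2 * √k := by positivity
  have h3 : 0 ≤ √(max Lam 0) * devConst d := by positivity
  nlinarith [abs_nonneg Y, mul_nonneg (abs_nonneg Y) this.le]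

theorem gramDev_le_of_le_sqrt {α : ℝ} (hbig : 4 * devConst d ≤ √k)
    (hdev : gramDev W₀ (k * α ^ 2) ≤ (devConst d * √k * α ^ 2) ^ 2) :
    gramDev W₀ (k * α ^ 2) ≤ (k * α ^ 2 / 4) ^ 2 := by
  refine hdev.trans ?_
  have hκ := devConst_pos d
  gcongr
  have h1 : √(k : ℝ) * √k = k := Real.mul_self_sqrt k.cast_nonneg
  have h2 : devConst d * √k ≤ √k / 4 * √k := by gcongr; linarith
  calc devConst d * √k * α ^ 2 ≤ √k / 4 * √k * α ^ 2 := by gcongr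
    _ = k * α ^ 2 / 4 := by linear_combination (α ^ 2 / 4) * h1

/-- Both flows exist and stay close to an initialization with nearly orthogonal rows. -/
theorem flows_of_gramDev_le {Y α : ℝ} (h : WellConditioned X lam Lam) (hY : ‖y‖ ≤ Y)
    (hlam : 0 < lam) (hk : 0 < k) (hα : 0 < α) (hbig : 4 * devConst d ≤ √k)
    (hdev : gramDev W₀ (k * α ^ 2) ≤ (devConst d * √k * α ^ 2) ^ 2) :
    (∃ W, IsGradientFlow (loss X y) W₀ W) ∧ (∃ WTK, IsGradientFlow (lossTK X y W₀) W₀ WTK) ∧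
      ∀ W WTK, IsGradientFlow (loss X y) W₀ W → IsGradientFlow (lossTK X y W₀) W₀ WTK →
        ∀ T, 0 ≤ T → ‖W T - W 0‖ ≤ travelConst d lam Lam Y * (1 / (α * √k) + α) ∧
          ‖W T - WTK T‖ ≤ 2 * (travelConst d lam Lam Y * (1 / (α * √k) + α)) := by
  have hk' : (0 : ℝ) < k := by exact_mod_cast hk
  have hm : 0 < k * α ^ 2 := by positivity
  have hdev' := gramDev_le_of_le_sqrt hbig hdev
  have hle := sqrt_loss_div_le h hY hlam hk hα hdev
  refine ⟨exists_isGradientFlow_of_bound (contDiff_loss X y) W₀ _ fun φ w hw t ht =>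
      hw.norm_sub_le_loss h hlam hm hdev' ht,
    exists_isGradientFlow_of_bound (contDiff_lossTK X y W₀) W₀ _ fun φ w hw t ht =>
      hw.norm_sub_le_lossTK h hlam hm hdev' ht, fun W WTK hW hTK T hT => ?_⟩
  have h1 := (hW.isSlowedGradientFlow.norm_sub_le_loss h hlam hm hdev' hT).trans hle
  have h2 := (hTK.isSlowedGradientFlow.norm_sub_le_lossTK h hlam hm hdev' hT).trans hle
  refine ⟨by rw [hW.1]; exact h1, ?_⟩
  have h3 := norm_sub_le_norm_sub_add_norm_sub (W T) W₀ (WTK T)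
  rw [norm_sub_rev W₀] at h3
  linarith

/-! ### Stability of the tangent kernel -/

theorem tangentKernel_eq (W : Param d k) (A B : Matrix (Fin d) (Fin d) ℝ) :
    tangentKernel W A B = inner ℝ (modelGrad k A W) (modelGrad k B W) := by
  rw [tangentKernel, gradient_predict, gradient_predict]

theorem sqrt_tangentKernel_self (W : Param d k) (A : Matrix (Fin d) (Fin d) ℝ) :
    √(tangentKernel W A A) = ‖modelGrad k A W‖ := by
  rw [tangentKernel_eq, real_inner_self_eq_norm_sq, Real.sqrt_sq (norm_nonneg _)]

theorem abs_inner_sub_inner_le {F : Type*} [NormedAddCommGroup F] [InnerProductSpace ℝ F]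
    {a b a' b' : F} {η : ℝ} (hη : 0 ≤ η) (ha : ‖a' - a‖ ≤ η * ‖a‖) (hb : ‖b' - b‖ ≤ η * ‖b‖) :
    |inner ℝ a' b' - inner ℝ a b| ≤ (2 * η + η ^ 2) * ‖a‖ * ‖b‖ := by
  have h : (inner ℝ a' b' - inner ℝ a b : ℝ) =
      inner ℝ (a' - a) (b' - b) + inner ℝ (a' - a) b + inner ℝ a (b' - b) := by
    simp only [inner_sub_left, inner_sub_right]
    ring
  rw [h]
  calc _ ≤ |inner ℝ (a' - a) (b' - b)| + |inner ℝ (a' - a) b| + |inner ℝ a (b' - b)| :=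
        abs_add_three _ _ _
    _ ≤ ‖a' - a‖ * ‖b' - b‖ + ‖a' - a‖ * ‖b‖ + ‖a‖ * ‖b' - b‖ := by
        gcongr <;> exact abs_real_inner_le_norm _ _
    _ ≤ (η * ‖a‖) * (η * ‖b‖) + (η * ‖a‖) * ‖b‖ + ‖a‖ * (η * ‖b‖) := by gcongr
    _ = _ := by ring

/-- The gradient is linear in `W`, so moving `W` by `η √(m / 2)` changes it by a relative amount at
most `η` when `√(m / 2)` bounds the gradient map `A ↦ ∇f(W₀, A)` from below. -/
theorem abs_tangentKernel_sub_le {W : Param d k} {η : ℝ} (hm : 0 < m) (hη : 0 ≤ η)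
    (hdev : gramDev W₀ m ≤ (m / 4) ^ 2) (hW : ‖W - W₀‖ ≤ η * √(m / 2))
    (A B : Matrix (Fin d) (Fin d) ℝ) :
    |tangentKernel W A B - tangentKernel W₀ A B| ≤
      (2 * η + η ^ 2) * √(tangentKernel W₀ A A) * √(tangentKernel W₀ B B) := by
  have key : ∀ A, ‖modelGrad k A W - modelGrad k A W₀‖ ≤ η * ‖modelGrad k A W₀‖ := by
    intro A
    rw [← map_sub]
    refine le_of_sq_le_sq ?_ (by positivity)
    have h1 := mul_frobInner_le_norm_sq_modelGrad hm hdev (fun z => rfl) A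
    have h2 := frobInner_self_nonneg A
    calc ‖modelGrad k A (W - W₀)‖ ^ 2 ≤ frobInner A A * ‖W - W₀‖ ^ 2 := norm_sq_modelGrad_le _ _
      _ ≤ frobInner A A * (η * √(m / 2)) ^ 2 := by gcongr
      _ = η ^ 2 * (m / 2 * frobInner A A) := by
          rw [mul_pow, Real.sq_sqrt (by positivity)]; ring
      _ ≤ η ^ 2 * ‖modelGrad k A W₀‖ ^ 2 := by gcongr
      _ = _ := by ring
  rw [sqrt_tangentKernel_self, sqrt_tangentKernel_self, tangentKernel_eq, tangentKernel_eq]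
  exact abs_inner_sub_inner_le hη (key A) (key B)

theorem le_norm_of_gramDev_le [NeZero d] (hm : 0 < m) (hdev : gramDev W₀ m ≤ (m / 4) ^ 2) :
    √m ≤ ‖W₀‖ := by
  have h1 : ‖W₀‖ ^ 2 = ∑ a, gram W₀ a a := by
    simp only [EuclideanSpace.norm_sq_eq, gram, Matrix.of_apply, Fintype.sum_prod_type,
      Real.norm_eq_abs, sq_abs, ← sq]
  have h2 : ∀ a, 3 / 4 * m ≤ gram W₀ a a := by
    intro a
    have h3 : (gram W₀ a a - m) ^ 2 ≤ gramDev W₀ m := by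
      refine le_trans ?_ (Finset.single_le_sum (f := fun a => ∑ b,
        (gram W₀ a b - if a = b then m else 0) ^ 2) (fun _ _ => by positivity)
        (Finset.mem_univ a))
      refine le_trans ?_ (Finset.single_le_sum (f := fun b =>
        (gram W₀ a b - if a = b then m else 0) ^ 2) (fun _ _ => by positivity)
        (Finset.mem_univ a))
      simp
    have := (abs_le_of_sq_le_sq' (h3.trans hdev) (by positivity)).1
    linarith
  refine Real.sqrt_le_iff.2 ⟨norm_nonneg _, ?_⟩
  rw [h1]
  have h3 : ∑ _a : Fin d ⊕ Fin d, 3 / 4 * m ≤ ∑ a, gram W₀ a a :=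
    Finset.sum_le_sum fun a _ => h2 a
  have hd : (1 : ℝ) ≤ d := by exact_mod_cast NeZero.one_le
  rw [Finset.sum_const, Finset.card_univ, Fintype.card_sum, Fintype.card_fin, nsmul_eq_mul,
    Nat.cast_add] at h3
  nlinarith

end

end MatrixFactorization

end

theorem mainTheorem6 (d : ℕ) (lam Lam Y : ℝ) (hlam : 0 < lam) :
    (∃ C : ℝ, 0 < C ∧ ∀ c₀ : ℝ, 0 < c₀ → ∃ K : ℕ, ∀ k : ℕ, K ≤ k →
      ∀ α : ℝ, 0 < α → c₀ / (k : ℝ) ≤ α ^ 2 →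
      ∀ (N : ℕ) (X : Fin N → Matrix (Fin d) (Fin d) ℝ) (y : EuclideanSpace ℝ (Fin N)),
      MatrixFactorization.WellConditioned X lam Lam → ‖y‖ ≤ Y →
      ∀ (Ω : Type*) [MeasurableSpace Ω] (P : Measure Ω) [IsProbabilityMeasure P]
        (W₀ : Ω → MatrixFactorization.Param d k),
      MatrixFactorization.IsGaussianInit P α W₀ →
      ∃ E : Set Ω, MeasurableSet E ∧
        ENNReal.ofReal (1 - 2 * Real.exp (-(d : ℝ))) ≤ P E ∧
        ∀ ω ∈ E,
          (∃ W, MatrixFactorization.IsGradientFlow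
            (MatrixFactorization.loss X y) (W₀ ω) W) ∧
          (∃ WTK, MatrixFactorization.IsGradientFlow
            (MatrixFactorization.lossTK X y (W₀ ω)) (W₀ ω) WTK) ∧
          ∀ W WTK : ℝ → MatrixFactorization.Param d k,
            MatrixFactorization.IsGradientFlow (MatrixFactorization.loss X y) (W₀ ω) W →
            MatrixFactorization.IsGradientFlow
              (MatrixFactorization.lossTK X y (W₀ ω)) (W₀ ω) WTK →
            ∀ T : ℝ, 0 ≤ T →
              ‖W T - W 0‖ ≤ C * (1 / (α * √(k : ℝ)) + α) ∧
              ‖W T - WTK T‖ ≤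
                C * (1 / (α ^ 3 * (k : ℝ) ^ (3 / 2 : ℝ)) + 1 / (α * √(k : ℝ)) + α)) ∧
    (∀ α : ℕ → ℝ, (∀ k, 0 < α k) →
      (fun k : ℕ => 1 / √(k : ℝ)) =o[atTop] (fun k : ℕ => α k ^ 2 * √(k : ℝ)) →
      ∀ ε : ℝ, 0 < ε → ∃ K : ℕ, ∀ k : ℕ, K ≤ k →
      ∀ (N : ℕ) (X : Fin N → Matrix (Fin d) (Fin d) ℝ) (y : EuclideanSpace ℝ (Fin N)),
      MatrixFactorization.WellConditioned X lam Lam → ‖y‖ ≤ Y →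
      ∀ (Ω : Type*) [MeasurableSpace Ω] (P : Measure Ω) [IsProbabilityMeasure P]
        (W₀ : Ω → MatrixFactorization.Param d k),
      MatrixFactorization.IsGaussianInit P (α k) W₀ →
      ∃ E : Set Ω, MeasurableSet E ∧
        ENNReal.ofReal (1 - 2 * Real.exp (-(d : ℝ))) ≤ P E ∧
        ∀ ω ∈ E,
          (∃ W, MatrixFactorization.IsGradientFlow
            (MatrixFactorization.loss X y) (W₀ ω) W) ∧
          (∃ WTK, MatrixFactorization.IsGradientFlow
            (MatrixFactorization.lossTK X y (W₀ ω)) (W₀ ω) WTK) ∧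
          ∀ W WTK : ℝ → MatrixFactorization.Param d k,
            MatrixFactorization.IsGradientFlow (MatrixFactorization.loss X y) (W₀ ω) W →
            MatrixFactorization.IsGradientFlow
              (MatrixFactorization.lossTK X y (W₀ ω)) (W₀ ω) WTK →
            ∀ T : ℝ, 0 ≤ T →
              ‖W T - WTK T‖ ≤ ε * ‖W 0‖ ∧
              ∀ A B : Matrix (Fin d) (Fin d) ℝ,
                |MatrixFactorization.tangentKernel (W T) A B
                    - MatrixFactorization.tangentKernel (W 0) A B| ≤
                  ε * √(MatrixFactorization.tangentKernel (W 0) A A)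
                    * √(MatrixFactorization.tangentKernel (W 0) B B)) := by
  have hκ := MatrixFactorization.devConst_pos d
  have hC := MatrixFactorization.travelConst_pos d Lam Y hlam
  set C := MatrixFactorization.travelConst d lam Lam Y with hCdef
  have hlarge : ∀ b : ℝ, ∀ᶠ k : ℕ in atTop, b ≤ √(k : ℝ) := fun b =>
    (Real.tendsto_sqrt_atTop.comp tendsto_natCast_atTop_atTop).eventually_ge_atTop b
  refine ⟨⟨2 * C, by positivity, fun c₀ _ => ?_⟩, fun α hα hlittle ε hε => ?_⟩
  · obtain ⟨K, hK⟩ := eventually_atTop.1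
      ((hlarge (4 * MatrixFactorization.devConst d)).and (eventually_gt_atTop 0))
    refine ⟨K, fun k hk α hα _ N X y hX hy Ω _ P _ W₀ hinit => ?_⟩
    obtain ⟨hbig, hk0⟩ := hK k hk
    obtain ⟨E, hE, hPE, hdev⟩ := hinit.exists_event hk0 hα
    refine ⟨E, hE, hPE, fun ω hω => ?_⟩
    obtain ⟨h1, h2, h3⟩ :=
      MatrixFactorization.flows_of_gramDev_le hX hy hlam hk0 hα hbig (hdev ω hω)
    refine ⟨h1, h2, fun W WTK hW hTK T hT => ?_⟩
    obtain ⟨h4, h5⟩ := h3 W WTK hW hTK T hT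
    have hpos : 0 ≤ C * (1 / (α * √(k : ℝ)) + α) := by positivity
    have hpos' : 0 ≤ 2 * C * (1 / (α ^ 3 * (k : ℝ) ^ (3 / 2 : ℝ))) := by positivity
    exact ⟨by linarith, by linarith⟩
  · -- `η` is chosen with `2 η + η² ≤ ε`, and `δ` so that both flows travel at most `η / 2` times
    -- `α √k`; this is at most `‖W₀‖` unless `d = 0`, where the parameter space is trivial
    set η : ℝ := min 1 (ε / 3) with hη
    have hη0 : 0 < η := lt_min one_pos (by positivity)
    have hη1 : η ≤ 1 := min_le_left _ _
    have hηε : η ≤ ε / 3 := min_le_right _ _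
    set δ : ℝ := η / (4 * C) with hδ
    have hδ0 : 0 < δ := by positivity
    obtain ⟨K, hK⟩ := eventually_atTop.1
      (((hlarge (4 * MatrixFactorization.devConst d)).and (eventually_gt_atTop 0)).and
        ((hlarge (1 / δ)).and (hlittle.bound hδ0)))
    refine ⟨K, fun k hk N X y hX hy Ω _ P _ W₀ hinit => ?_⟩
    obtain ⟨⟨hbig, hk0⟩, hδk, hlk⟩ := hK k hk
    obtain ⟨E, hE, hPE, hdev⟩ := hinit.exists_event hk0 (hα k)
    refine ⟨E, hE, hPE, fun ω hω => ?_⟩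
    obtain ⟨h1, h2, h3⟩ :=
      MatrixFactorization.flows_of_gramDev_le hX hy hlam hk0 (hα k) hbig (hdev ω hω)
    refine ⟨h1, h2, fun W WTK hW hTK T hT => ?_⟩
    obtain ⟨h4, h5⟩ := h3 W WTK hW hTK T hT
    have hα0 := hα k
    have hk' : (0 : ℝ) < k := by exact_mod_cast hk0
    have hsk : 0 < √(k : ℝ) := Real.sqrt_pos.2 hk'
    have hm : 0 < (k : ℝ) * α k ^ 2 := by positivity
    have hsm : √((k : ℝ) * α k ^ 2) = α k * √(k : ℝ) := by
      rw [Real.sqrt_mul hk'.le, Real.sqrt_sq hα0.le, mul_comm]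
    have hdev' := MatrixFactorization.gramDev_le_of_le_sqrt hbig (hdev ω hω)
    have htravel : C * (1 / (α k * √(k : ℝ)) + α k) ≤ η / 2 * (α k * √(k : ℝ)) := by
      rw [Real.norm_of_nonneg (by positivity), Real.norm_of_nonneg (by positivity)] at hlk
      have e1 : 1 / (α k * √(k : ℝ)) ≤ δ * (α k * √(k : ℝ)) := by
        calc 1 / (α k * √(k : ℝ)) = 1 / √(k : ℝ) / α k := by field_simp
          _ ≤ δ * (α k ^ 2 * √(k : ℝ)) / α k := by gcongr
          _ = δ * (α k * √(k : ℝ)) := by field_simp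
      have e2 : α k ≤ δ * (α k * √(k : ℝ)) := by
        rw [div_le_iff₀ hδ0] at hδk
        nlinarith
      calc C * (1 / (α k * √(k : ℝ)) + α k)
          ≤ C * (δ * (α k * √(k : ℝ)) + δ * (α k * √(k : ℝ))) := by gcongr
        _ = η / 2 * (α k * √(k : ℝ)) := by rw [hδ]; field_simp; ring
    rw [hW.1] at h4 ⊢
    refine ⟨?_, fun A B => ?_⟩
    · rcases Nat.eq_zero_or_pos d with rfl | hd
      · rw [Subsingleton.elim (W T) (WTK T), sub_self, norm_zero]
        positivity
      · have : NeZero d := ⟨hd.ne'⟩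
        have hW0 := MatrixFactorization.le_norm_of_gramDev_le hm hdev'
        rw [hsm] at hW0
        calc ‖W T - WTK T‖ ≤ η * (α k * √(k : ℝ)) := by linarith
          _ ≤ ε * ‖W₀ ω‖ := by gcongr; linarith
    · have hW' : ‖W T - W₀ ω‖ ≤ η * √((k : ℝ) * α k ^ 2 / 2) := by
        refine h4.trans (htravel.trans ?_)
        rw [div_mul_eq_mul_div, mul_div_assoc]
        gcongr
        refine Real.le_sqrt_of_sq_le ?_
        rw [div_pow, mul_pow, Real.sq_sqrt hk'.le]
        nlinarith
      refine (MatrixFactorization.abs_tangentKernel_sub_le hm hη0.le hdev' hW' A B).trans ?_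
      gcongr
      nlinarith
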